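/- Let $a\in\mathbb C\setminus\{0,-1\}$ and let $\mathfrak g=D(2,1;a)$ be the 17-dimensional Lie superalgebra with even part $\mathfrak{sl}_2\oplus\mathfrak{sl}_2\oplus\mathfrak{sl}_2$ and odd part $\mathbb C^2\otimes\mathbb C^2\otimes\mathbb C^2$, with Cartan subalgebra $\mathfrak h$, odd isotropic simple roots $\alpha_1,\alpha_2,\alpha_3$, and invariant supersymmetric bilinear form normalized by $$(\alpha_1|\alpha_2)=a,\qquad (\alpha_1|\alpha_3)=-(a+1),\qquad (\alpha_2|\alpha_3)=1 .$$ Let $\widehat{\mathfrak g}=\mathfrak g[t,t^{-1}]\oplus\mathbb CK\oplus\mathbb Cd$ be the affine Lie superalgebra, where $[xt^r,yt^s]=[x,y]t^{r+s}+r\,\delta_{r,-s}(x|y)K$, $K$ is central and $[d,xt^r]=r\,xt^r$. Its Cartan subalgebra is $\widehat{\mathfrak h}=\mathfrak h+\mathbb CK+\mathbb Cd$. Let $\delta\in\widehat{\mathfrak h}^*$ be $1$ on $d$ and $0$ on $\mathfrak h+\mathbb CK$, and take the simple roots $\alpha_0=\delta-(\alpha_1+\alpha_2+\alpha_3),\alpha_1,\alpha_2,\alpha_3$.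 Let $\Lambda_0,\dots,\Lambda_3\in\widehat{\mathfrak h}^*$ be fundamental weights, $(\Lambda_i|\alpha_j)=\delta_{ij}$; they are determined up to multiples of $\delta$. For $\Lambda\in\widehat{\mathfrak h}^*$ let $L(\Lambda)$ be the irreducible $\widehat{\mathfrak g}$-module with a non-zero even vector that is annihilated by all positive root spaces and on which $\widehat{\mathfrak h}$ acts by $\Lambda$. The level of $L(\Lambda)$ is $k=\Lambda(K)$. For a root $\gamma$, $L(\Lambda)$ is called $\gamma$-integrable if the root space $\widehat{\mathfrak g}_{-\gamma}$ acts locally nilpotently on it. It is called integrable if it is $\gamma$-integrable for $\gamma=\alpha_1+\alpha_2$, for $\gamma=\alpha_1+\alpha_3$, and for all $\gamma=\alpha+n\delta$ with $\alpha\in\{\pm(\alpha_1+\alpha_2),\pm(\alpha_1+\alpha_3)\}$ and $n\ge 1$. Let $m_0,\dots,m_3\in\mathbb C$ and $\Lambda=\sum_{i=0}^3 m_i\Lambda_i$ up to adding a multiple of $\delta$. Then $k=\sum_{i=0}^3 m_i$, and: (a) $L(\Lambda)$ is integrable if and only if (i) $\frac{m_1+m_2}{a}$, $\frac{m_0+m_3}{a}$,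 $-\frac{m_1+m_3}{a+1}$ and $-\frac{m_0+m_2}{a+1}$ are non-negative integers, and (ii) for $i\in\{0,1\}$ and $j\in\{2,3\}$, $m_i+m_j=0$ implies $m_i=m_j=0$. (b) $L(\Lambda)$ is $(\alpha_0+\alpha_1)$-integrable if and only if $m_0+m_1\in\mathbb Z_{\ge0}$, and $m_0+m_1=0$ implies $m_0=m_1=0$. It is $(\alpha_2+\alpha_3)$-integrable if and only if $m_2+m_3\in\mathbb Z_{\ge0}$, and $m_2+m_3=0$ implies $m_2=m_3=0$. (c) If $L(\Lambda)$ is integrable and $k\ne0$, then there are coprime positive integers $p,q$ and a positive integer $n$ such that $$a=-\frac{p}{p+q}\qquad\text{and}\qquad k=-\frac{pqn}{p+q}.$$ In particular $a\in\mathbb Q$ and $-1<a<0$. -/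

import Mathlib

namespace D21

open scoped BigOperators

noncomputable section

/-! ### The Lie superalgebra `D(2,1;a)`

The even part is `sl₂ ⊕ sl₂ ⊕ sl₂`, the odd part is `ℂ² ⊗ ℂ² ⊗ ℂ²`, whose elements are written as
coefficient functions on the basis `e_{s 0} ⊗ e_{s 1} ⊗ e_{s 2}`, `s : Fin 3 → Fin 2`. -/

/-- The Lie algebra of traceless complex `2 × 2` matrices. -/
abbrev SL2 : Type := LieAlgebra.SpecialLinear.sl (Fin 2) ℂ

/-- The even part `sl₂ ⊕ sl₂ ⊕ sl₂`. -/
abbrev Even : Type := Fin 3 → SL2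

/-- The odd part `ℂ² ⊗ ℂ² ⊗ ℂ²`. -/
abbrev Odd : Type := (Fin 3 → Fin 2) → ℂ

/-- The underlying space of `D(2,1;a)`, even part times odd part. -/
abbrev G : Type := Even × Odd

/-- The three structure constants, of sum zero; they are half the square lengths of the even
roots of the three `sl₂`'s, which are `1`, `-(a+1)` and `a`. -/
def sigma (a : ℂ) : Fin 3 → ℂ := ![1, -(a + 1), a]

/-- The standard symplectic form of `ℂ²` on basis vectors. -/
def psi : Fin 2 → Fin 2 → ℂ := ![![0, 1], ![-1, 0]]

/-- The symmetric map `ℂ² × ℂ² → sl₂`, `p(x,y) z = ψ(y,z) x + ψ(x,z) y`, on basis vectors. -/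
def pMat (b c : Fin 2) : Matrix (Fin 2) (Fin 2) ℂ := fun k l =>
  (if k = b then psi c l else 0) + (if k = c then psi b l else 0)

theorem trace_pMat (b c : Fin 2) : (pMat b c).trace = 0 := by
  fin_cases b <;> fin_cases c <;> simp [pMat, psi, Matrix.trace, Fin.sum_univ_two]

/-- `p(e_b, e_c)` as an element of `sl₂`. -/
def p (b c : Fin 2) : SL2 :=
  ⟨pMat b c, trace_pMat b c⟩

/-- The action of `sl₂ ⊕ sl₂ ⊕ sl₂` on `ℂ² ⊗ ℂ² ⊗ ℂ²`. -/
def evenAct (A : Even) (u : Odd) : Odd := fun s =>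
  ∑ i : Fin 3, ∑ j : Fin 2, (A i : Matrix (Fin 2) (Fin 2) ℂ) (s i) j * u (Function.update s i j)

/-- The bracket of two odd elements: on pure tensors its `i`-th component is
`σ_i ∏_{j ≠ i} ψ(u_j, w_j) p(u_i, w_i)`. -/
def oddBracket (a : ℂ) (u w : Odd) : Even := fun i =>
  ∑ s : Fin 3 → Fin 2, ∑ t : Fin 3 → Fin 2,
    (sigma a i * u s * w t * ∏ j ∈ Finset.univ.erase i, psi (s j) (t j)) • p (s i) (t i)

/-- The superbracket of `D(2,1;a)`. -/
def bracket (a : ℂ) (x y : G) : G :=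
  ((fun i => ⁅x.1 i, y.1 i⁆) + oddBracket a x.2 y.2, evenAct x.1 y.2 - evenAct y.1 x.2)

/-- The invariant supersymmetric bilinear form of `D(2,1;a)`. -/
def form (a : ℂ) (x y : G) : ℂ :=
  (∑ i : Fin 3, (sigma a i)⁻¹ *
    ((x.1 i : Matrix (Fin 2) (Fin 2) ℂ) * (y.1 i : Matrix (Fin 2) (Fin 2) ℂ)).trace)
  - 2 * ∑ s : Fin 3 → Fin 2, ∑ t : Fin 3 → Fin 2, x.2 s * y.2 t * ∏ j : Fin 3, psi (s j) (t j)

/-! ### The affine Lie superalgebra `g[t, t⁻¹] ⊕ ℂ K ⊕ ℂ d` -/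

/-- The underlying space: a triple `(x, b, c)` stands for `∑ x_n t^n + b K + c d`. -/
abbrev Aff : Type := (ℤ →₀ G) × ℂ × ℂ

/-- `t d/dt` on the loop algebra. -/
def loopDegree (x : ℤ →₀ G) : ℤ →₀ G := x.sum fun n u => Finsupp.single n ((n : ℂ) • u)

/-- The superbracket: `[u t^m, w t^n] = [u,w] t^{m+n} + m δ_{m,-n} (u|w) K`, `K` is central,
and `[d, u t^n] = n u t^n`. -/
def affBracket (a : ℂ) (x y : Aff) : Aff :=
  ((x.1.sum fun m u => y.1.sum fun n w => Finsupp.single (m + n) (bracket a u w))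
      + x.2.2 • loopDegree y.1 - y.2.2 • loopDegree x.1,
    x.1.sum fun m u => (m : ℂ) * form a u (y.1 (-m)),
    0)

/-- The invariant form: `(u t^m | w t^n) = δ_{m,-n} (u|w)`, `(K|d) = 1`, and `K`, `d` are
isotropic and orthogonal to the loop algebra. -/
def affForm (a : ℂ) (x y : Aff) : ℂ :=
  (x.1.sum fun m u => form a u (y.1 (-m))) + x.2.1 * y.2.2 + x.2.2 * y.2.1

/-- The elements of parity `i`; `K` and `d` are even. -/
def parity (i : ZMod 2) : Set Aff :=
  if i = 0 then {x | ∀ n, (x.1 n).2 = 0} else {x | (∀ n, (x.1 n).1 = 0) ∧ x.2 = 0}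

/-! ### The Cartan subalgebra, weights and roots -/

/-- Coordinates on the Cartan subalgebra: `(h, b, c)` stands for
`∑ h_i diag(1,-1)_i + b K + c d`. -/
abbrev Cartan : Type := (Fin 3 → ℂ) × ℂ × ℂ

/-- Weights: the dual of the Cartan subalgebra. -/
abbrev Weight : Type := Module.Dual ℂ Cartan

/-- `diag(1,-1)`. -/
def hSL2 : SL2 :=
  ⟨!![1, 0; 0, -1], by
    change Matrix.trace (!![1, 0; 0, -1] : Matrix (Fin 2) (Fin 2) ℂ) = 0
    simp [Matrix.trace_fin_two]⟩

/-- The Cartan subalgebra inside the affine superalgebra. -/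
def cartan (h : Cartan) : Aff :=
  (Finsupp.single 0 ((fun i => h.1 i • hSL2), 0), h.2.1, h.2.2)

/-- The `i`-th `diag(1,-1)`, `K` and `d` in the Cartan subalgebra. -/
def cartanH (i : Fin 3) : Cartan := (Pi.single i 1, 0, 0)

/-- The central element. -/
def cartanK : Cartan := (0, 1, 0)

/-- The scaling element. -/
def cartanD : Cartan := (0, 0, 1)

/-- `ε_i`: the `i`-th diagonal coordinate. The even roots of `g` are `± 2 ε_i` and the odd ones
are `± ε_0 ± ε_1 ± ε_2`. -/
def eps (i : Fin 3) : Weight := LinearMap.proj i ∘ₗ LinearMap.fst ℂ (Fin 3 → ℂ) (ℂ × ℂ)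

/-- The weight `δ`, which is `1` on `d` and vanishes on `K` and on the Cartan subalgebra of `g`. -/
def delta : Weight := LinearMap.snd ℂ ℂ ℂ ∘ₗ LinearMap.snd ℂ (Fin 3 → ℂ) (ℂ × ℂ)

/-- The affine simple roots `α_0 = δ - (α_1 + α_2 + α_3)`, `α_1`, `α_2`, `α_3`. -/
def simpleRoot : Fin 4 → Weight :=
  ![delta - (eps 0 + eps 1 + eps 2),
    - eps 0 + eps 1 + eps 2,
    eps 0 - eps 1 + eps 2,
    eps 0 + eps 1 - eps 2]

/-- The identification of weights with elements of the Cartan subalgebra by the invariant form. -/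
def toCartan (a : ℂ) (μ : Weight) : Cartan :=
  (fun i => sigma a i / 2 * μ (cartanH i), μ cartanD, μ cartanK)

/-- The bilinear form on weights induced by the invariant form. -/
def weightForm (a : ℂ) (lam μ : Weight) : ℂ := lam (toCartan a μ)

theorem affForm_toCartan (a : ℂ) (ha0 : a ≠ 0) (ha1 : a ≠ -1) (μ : Weight) (h : Cartan) :
    affForm a (cartan (toCartan a μ)) (cartan h) = μ h := by
  have hs : ∀ i, sigma a i ≠ 0 := by
    have : a + 1 ≠ 0 := fun h => ha1 (eq_neg_of_add_eq_zero_left h)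
    intro i
    fin_cases i
    · simp [sigma]
    · exact neg_ne_zero.2 this
    · simpa [sigma] using ha0
  have hh : h = ∑ i, h.1 i • cartanH i + h.2.1 • cartanK + h.2.2 • cartanD := by
    obtain ⟨f, b, c⟩ := h
    refine Prod.ext ?_ (Prod.ext ?_ ?_)
    · funext j
      fin_cases j <;> simp [cartanH, cartanK, cartanD, Fin.sum_univ_three]
    · simp [cartanH, cartanK, cartanD, Fin.sum_univ_three]
    · simp [cartanH, cartanK, cartanD, Fin.sum_univ_three]
  have hf : form a 0 (((fun i => h.1 i • hSL2), 0) : G) = 0 := by simp [form]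
  have h2 : μ h = ∑ i, h.1 i * μ (cartanH i) + h.2.1 * μ cartanK + h.2.2 * μ cartanD := by
    conv_lhs => rw [hh]
    simp [map_sum]
  have h3 : ∀ c d : ℂ, ((c • hSL2 : SL2) : Matrix (Fin 2) (Fin 2) ℂ) = !![c, 0; 0, -c] := by
    intro c d
    ext i j
    fin_cases i <;> fin_cases j <;> simp [hSL2]
  rw [h2]
  simp only [affForm, cartan]
  rw [Finsupp.sum_single_index (by simpa using hf)]
  simp only [neg_zero, Finsupp.single_eq_same, form, toCartan, h3 _ 0]
  simp [Matrix.trace_fin_two, Fin.sum_univ_three]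
  have := hs 0
  have := hs 1
  have := hs 2
  field_simp
  ring

/-- The Gram matrix of the affine simple roots: all of them are isotropic, and
`(α_1|α_2) = a`, `(α_1|α_3) = -(a+1)`, `(α_2|α_3) = 1`. -/
theorem weightForm_simpleRoot (a : ℂ) (i j : Fin 4) :
    weightForm a (simpleRoot i) (simpleRoot j) =
      !![0, 1, -(a + 1), a; 1, 0, a, -(a + 1); -(a + 1), a, 0, 1; a, -(a + 1), 1, 0] i j := by
  fin_cases i <;> fin_cases j <;>
    simp [weightForm, simpleRoot, toCartan, cartanH, cartanK, cartanD, eps, delta, sigma] <;> ring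

/-- The fundamental weights, `(Λ_i | α_j^∨) = δ_{ij}`, where `α_j^∨ = α_j` since all simple roots
are isotropic. They are determined up to multiples of `δ`. -/
def IsFundamentalWeights (a : ℂ) (w : Fin 4 → Weight) : Prop :=
  ∀ i j, weightForm a (w i) (simpleRoot j) = if i = j then 1 else 0

/-- The root space of a weight `γ`: all `x` with `[h, x] = γ(h) x` for `h` in the Cartan
subalgebra. -/
def rootSpace (a : ℂ) (γ : Weight) : Set Aff :=
  {x | ∀ h : Cartan, affBracket a (cartan h) x = γ h • x}

/-- The positive affine roots: the non-zero weights with a non-zero root space that are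
combinations of simple roots with non-negative integer coefficients. -/
def positiveRoots (a : ℂ) : Set Weight :=
  {γ | γ ≠ 0 ∧ (∃ x ∈ rootSpace a γ, x ≠ 0) ∧ ∃ c : Fin 4 → ℕ, γ = ∑ i, c i • simpleRoot i}

/-- The roots of the subalgebra `sl₂ ⊕ sl₂` of the even part with simple roots `α_1 + α_2` and
`α_1 + α_3`. -/
def sharpRoots : Set Weight :=
  {simpleRoot 1 + simpleRoot 2, -(simpleRoot 1 + simpleRoot 2),
    simpleRoot 1 + simpleRoot 3, -(simpleRoot 1 + simpleRoot 3)}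

/-! ### Modules -/

/-- A module over the affine Lie superalgebra on a complex vector space `V`, with a
`ℤ/2`-grading of `V`. -/
structure Rep (a : ℂ) (V : Type*) [AddCommGroup V] [Module ℂ V] where
  /-- the `ℤ/2`-grading -/
  grading : ZMod 2 → Submodule ℂ V
  isCompl_grading : IsCompl (grading 0) (grading 1)
  /-- the action -/
  act : Aff →ₗ[ℂ] Module.End ℂ V
  act_mem : ∀ i j : ZMod 2, ∀ x ∈ parity i, ∀ v ∈ grading j, act x v ∈ grading (i + j)
  act_bracket : ∀ i j : ZMod 2, ∀ x ∈ parity i, ∀ y ∈ parity j,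
    act (affBracket a x y) = act x * act y - (-1 : ℂ) ^ (i.val * j.val) • (act y * act x)

namespace Rep

variable {a : ℂ} {V : Type*} [AddCommGroup V] [Module ℂ V] (ρ : Rep a V)

/-- Irreducibility: `V ≠ 0`, and the only graded invariant subspaces are `0` and `V`. -/
def IsIrreducible : Prop :=
  Nontrivial V ∧ ∀ N : Submodule ℂ V,
    (∀ x : Aff, ∀ v ∈ N, ρ.act x v ∈ N) →
    N = (N ⊓ ρ.grading 0) ⊔ (N ⊓ ρ.grading 1) → N = ⊥ ∨ N = ⊤

/-- `v` is a highest weight vector of weight `Λ`: a non-zero even vector, killed by all positive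
root spaces, on which the Cartan subalgebra acts by `Λ`. -/
def IsHighestWeightVector (Λ : Weight) (v : V) : Prop :=
  v ≠ 0 ∧ v ∈ ρ.grading 0 ∧
    (∀ γ ∈ positiveRoots a, ∀ x ∈ rootSpace a γ, ρ.act x v = 0) ∧
    ∀ h : Cartan, ρ.act (cartan h) v = Λ h • v

/-- The module is the highest weight module `L(Λ)`: it is irreducible and has a highest weight
vector of weight `Λ`. -/
def IsL (Λ : Weight) : Prop := ρ.IsIrreducible ∧ ∃ v : V, ρ.IsHighestWeightVector Λ v

/-- `γ`-integrability: the root space of `-γ` acts locally nilpotently. -/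
def IsIntegrableAt (γ : Weight) : Prop :=
  ∀ x ∈ rootSpace a (-γ), ∀ v : V, ∃ n : ℕ, (ρ.act x ^ n) v = 0

/-- Integrability with respect to the affinization of `sl₂ ⊕ sl₂`: `γ`-integrability for its
positive real roots. -/
def IsIntegrable : Prop :=
  ρ.IsIntegrableAt (simpleRoot 1 + simpleRoot 2) ∧
  ρ.IsIntegrableAt (simpleRoot 1 + simpleRoot 3) ∧
  ∀ α ∈ sharpRoots, ∀ n : ℕ, 0 < n → ρ.IsIntegrableAt (α + n • delta)

end Rep

/-- Being a non-negative integer. -/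
def IsNat (z : ℂ) : Prop := ∃ n : ℕ, z = n

end

end D21

/-! For i ≠ j the root β = α_i + α_j is an even real root ±2ε_k + nδ with n ∈ {0, 1}. It is not
simple, but it becomes simple after the odd reflection in α_i. Let v be the highest weight vector
and f a root vector for -α_i. The highest weight vector for the reflected positive system is v when
m_i = 0, and f v, of weight Λ - α_i, when m_i ≠ 0 (`Rep.IsSingular.exists_reflected`). For a simple
even root, sl₂ theory applies: the root space of -β acts locally nilpotently exactly when the
highest weight is a natural number on the coroot (`Rep.IsSingular.locNilp_iff`). On the coroot of β,
Λ has the value (m_i + m_j)/σ_k and α_i the value 1. Hence (m_i + m_j)/σ_k must be natural, and the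
value 0 is allowed only if m_i = 0. This is `Rep.IsL.isIntegrableAt_iff_label`; it gives (b) and the
four conditions of (a).

All vanishing statements come from weights. An irreducible module is spanned by words of negative
root vectors applied to any non-zero singular vector (`Rep.wordSpan_eq_top`). So a vector whose
weight is not below the highest one is zero (`Rep.IsSingular.eq_zero_of_pos`), and so is a singular
vector of smaller weight (`Rep.IsSingular.eq_zero`). Roots are handled as integer coordinate
vectors, for which positivity is linear arithmetic.

Integrability involves infinitely many real roots. If f and x are locally nilpotent and (ad f)³ x =
0, then (ad f)² x is locally nilpotent (`LocNilp.comm_comm`); inside an affine sl₂ this passes from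
the two simple roots to all real ones (`Rep.IsL.locNilp_loop`). Only α_1 + α_2, α_0 + α_3, α_1 + α_3
and α_0 + α_2 remain.

For (c), adding the integrality conditions in pairs gives k = aA = -(a+1)B with natural A and B, and
`exists_coprime_of_level` solves for a and k. -/

namespace D21

open scoped BigOperators

noncomputable section

/-! ### Brackets of loop elements -/

/-- The element `u t^n`. -/
def loop (n : ℤ) (u : G) : Aff := (Finsupp.single n u, 0, 0)

/-- The matrix unit `e` of `sl₂`. -/
def eSL2 : SL2 :=
  ⟨!![0, 1; 0, 0], by
    change Matrix.trace (!![0, 1; 0, 0] : Matrix (Fin 2) (Fin 2) ℂ) = 0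
    simp [Matrix.trace_fin_two]⟩

/-- The matrix unit `f` of `sl₂`. -/
def fSL2 : SL2 :=
  ⟨!![0, 0; 1, 0], by
    change Matrix.trace (!![0, 0; 1, 0] : Matrix (Fin 2) (Fin 2) ℂ) = 0
    simp [Matrix.trace_fin_two]⟩

/-- An element of `sl₂` placed in the `k`-th summand of the even part. -/
def evenG (k : Fin 3) (N : SL2) : G := (Pi.single k N, 0)

/-- The basis vector `e_{s 0} ⊗ e_{s 1} ⊗ e_{s 2}` of the odd part. -/
def oddG (s : Fin 3 → Fin 2) : G := (0, Pi.single s 1)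

@[simp] theorem evenAct_zero_left (u : Odd) : evenAct 0 u = 0 := by
  funext s; simp [evenAct]

@[simp] theorem evenAct_zero_right (A : Even) : evenAct A 0 = 0 := by
  funext s; simp [evenAct]

@[simp] theorem oddBracket_zero_left (a : ℂ) (u : Odd) : oddBracket a 0 u = 0 := by
  funext s; simp [oddBracket]

@[simp] theorem oddBracket_zero_right (a : ℂ) (u : Odd) : oddBracket a u 0 = 0 := by
  funext s; simp [oddBracket]

@[simp] theorem bracket_zero_left (a : ℂ) (u : G) : bracket a 0 u = 0 := by
  ext1
  · funext i; simp [bracket]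
  · simp [bracket]

@[simp] theorem bracket_zero_right (a : ℂ) (u : G) : bracket a u 0 = 0 := by
  ext1
  · funext i; simp [bracket]
  · simp [bracket]

@[simp] theorem form_zero_left (a : ℂ) (u : G) : form a 0 u = 0 := by
  simp [form]

@[simp] theorem form_zero_right (a : ℂ) (u : G) : form a u 0 = 0 := by
  simp [form]

theorem affBracket_loop (a : ℂ) (m n : ℤ) (u w : G) :
    affBracket a (loop m u) (loop n w) =
      (Finsupp.single (m + n) (bracket a u w), if n = -m then (m : ℂ) * form a u w else 0, 0) := by
  have h1 : ∀ u' : G, (Finsupp.single n w).sum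
      (fun n w => Finsupp.single (m + n) (bracket a u' w)) =
        Finsupp.single (m + n) (bracket a u' w) := fun u' =>
    Finsupp.sum_single_index (by simp)
  ext1
  · simp only [affBracket, loop, zero_smul, add_zero, sub_zero]
    rw [Finsupp.sum_single_index (by simp [Finsupp.sum]), h1]
  · ext1
    · simp only [affBracket, loop]
      rw [Finsupp.sum_single_index (by simp)]
      rw [Finsupp.single_apply]
      split_ifs <;> simp
    · simp [affBracket]

theorem affBracket_loop_of_form_eq_zero {a : ℂ} {u w : G} (h : form a u w = 0) (m n : ℤ) :
    affBracket a (loop m u) (loop n w) = loop (m + n) (bracket a u w) := by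
  rw [affBracket_loop, h]; simp [loop]

theorem loop_smul (n : ℤ) (c : ℂ) (u : G) : loop n (c • u) = c • loop n u := by
  simp [loop]

/-- The Cartan subalgebra of `g` inside `g`. -/
def cartanG (h : Cartan) : G := ((fun i => h.1 i • hSL2), 0)

theorem loopDegree_apply (x : ℤ →₀ G) (n : ℤ) : loopDegree x n = (n : ℂ) • x n := by
  classical
  simp only [loopDegree, Finsupp.sum_apply, Finsupp.single_apply]
  rw [Finsupp.sum_ite_eq']
  split_ifs with h
  · rfl
  · rw [Finsupp.notMem_support_iff.1 h, smul_zero]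

theorem affBracket_cartan_fst (a : ℂ) (h : Cartan) (x : Aff) (n : ℤ) :
    (affBracket a (cartan h) x).1 n =
      bracket a (cartanG h) (x.1 n) + (h.2.2 * n) • x.1 n := by
  classical
  have h0 : loopDegree (Finsupp.single 0 (cartanG h)) = 0 := by
    ext1 m
    rw [loopDegree_apply, Finsupp.single_apply]
    split_ifs with hm
    · simp [← hm]
    · simp
  have h1 : (Finsupp.single 0 (cartanG h) : ℤ →₀ G).sum (fun m u => x.1.sum fun n w =>
      Finsupp.single (m + n) (bracket a u w)) = x.1.sum fun n w =>
      Finsupp.single n (bracket a (cartanG h) w) := by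
    rw [Finsupp.sum_single_index (by simp [Finsupp.sum])]
    simp
  have h2 : (x.1.sum fun n w => Finsupp.single n (bracket a (cartanG h) w)) n =
      bracket a (cartanG h) (x.1 n) := by
    simp only [Finsupp.sum_apply, Finsupp.single_apply]
    rw [Finsupp.sum_ite_eq']
    split_ifs with h
    · rfl
    · rw [Finsupp.notMem_support_iff.1 h, bracket_zero_right]
  change ((Finsupp.single 0 (cartanG h) : ℤ →₀ G).sum (fun m u => x.1.sum fun n w =>
      Finsupp.single (m + n) (bracket a u w)) + h.2.2 • loopDegree x.1 -
      x.2.2 • loopDegree (Finsupp.single 0 (cartanG h)) : ℤ →₀ G) n = _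
  rw [h0, h1, smul_zero, sub_zero, Finsupp.add_apply, h2, Finsupp.smul_apply, loopDegree_apply,
    smul_smul]

theorem affBracket_cartan_snd (a : ℂ) (h : Cartan) (x : Aff) :
    (affBracket a (cartan h) x).2 = 0 := by
  ext1
  · simp only [affBracket, cartan]
    rw [Finsupp.sum_single_index (by simp)]
    simp
  · rfl

theorem bracket_cartanG_fst (a : ℂ) (h : Cartan) (u : G) (i : Fin 3) (k l : Fin 2) :
    ((bracket a (cartanG h) u).1 i : Matrix (Fin 2) (Fin 2) ℂ) k l =
      (h.1 i * (![![0, 2], ![-2, 0]] k l)) * (u.1 i : Matrix (Fin 2) (Fin 2) ℂ) k l := by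
  simp only [bracket, cartanG, oddBracket_zero_left, add_zero, LieSubalgebra.coe_bracket]
  rw [Ring.lie_def]
  fin_cases k <;> fin_cases l <;>
    simp [hSL2, Matrix.sub_apply, Matrix.mul_apply, Matrix.vecMul, dotProduct,
      Fin.sum_univ_two] <;> ring

/-- The eigenvalue of `diag(1,-1)` on a basis vector of `ℂ²`. -/
def sgn (b : Fin 2) : ℤ := ![1, -1] b

theorem bracket_cartanG_snd (a : ℂ) (h : Cartan) (u : G) (s : Fin 3 → Fin 2) :
    (bracket a (cartanG h) u).2 s = (∑ i, h.1 i * sgn (s i)) * u.2 s := by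
  simp only [bracket, cartanG, evenAct_zero_right, sub_zero, evenAct]
  rw [Finset.sum_mul]
  refine Finset.sum_congr rfl fun i _ => ?_
  rw [Finset.sum_eq_single (s i)]
  · rw [Function.update_eq_self]
    generalize s i = b
    fin_cases b <;> simp [hSL2, sgn]
  · intro b _ hb
    have : ((h.1 i • hSL2 : SL2) : Matrix (Fin 2) (Fin 2) ℂ) (s i) b = 0 := by
      generalize s i = b' at hb
      fin_cases b <;> fin_cases b' <;> simp_all [hSL2]
    rw [this, zero_mul]
  · simp

theorem bracket_evenG_evenG (a : ℂ) (k : Fin 3) (N M : SL2) :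
    bracket a (evenG k N) (evenG k M) = evenG k ⁅N, M⁆ := by
  ext1
  · funext i
    by_cases h : i = k
    · subst h; simp [bracket, evenG]
    · simp [bracket, evenG, h]
  · simp [bracket, evenG]

theorem form_evenG_evenG (a : ℂ) (k : Fin 3) (N M : SL2) :
    form a (evenG k N) (evenG k M) = (sigma a k)⁻¹ *
      ((N : Matrix (Fin 2) (Fin 2) ℂ) * (M : Matrix (Fin 2) (Fin 2) ℂ)).trace := by
  simp only [form, evenG]
  rw [Finset.sum_eq_single k]
  · simp
  · intro b _ hb; simp [hb]
  · simp

theorem coe_lie (N M : SL2) : ((⁅N, M⁆ : SL2) : Matrix (Fin 2) (Fin 2) ℂ) =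
    (N : Matrix (Fin 2) (Fin 2) ℂ) * M - (M : Matrix (Fin 2) (Fin 2) ℂ) * N := by
  simp only [LieSubalgebra.coe_bracket, Ring.lie_def]

theorem lie_eSL2_fSL2 : ⁅eSL2, fSL2⁆ = hSL2 := by
  ext i j
  rw [coe_lie]
  fin_cases i <;> fin_cases j <;> simp [eSL2, fSL2, hSL2]

theorem lie_hSL2_eSL2 : ⁅hSL2, eSL2⁆ = (2 : ℂ) • eSL2 := by
  ext i j
  rw [coe_lie]
  fin_cases i <;> fin_cases j <;> simp [eSL2, hSL2]
  norm_num

theorem lie_hSL2_fSL2 : ⁅hSL2, fSL2⁆ = (-2 : ℂ) • fSL2 := by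
  ext i j
  rw [coe_lie]
  fin_cases i <;> fin_cases j <;> simp [fSL2, hSL2]
  norm_num

theorem coe_eSL2_mul_self : (eSL2 : Matrix (Fin 2) (Fin 2) ℂ) * eSL2 = 0 := by
  ext i j; fin_cases i <;> fin_cases j <;> simp [eSL2]

theorem coe_fSL2_mul_self : (fSL2 : Matrix (Fin 2) (Fin 2) ℂ) * fSL2 = 0 := by
  ext i j; fin_cases i <;> fin_cases j <;> simp [fSL2]

/-! ### Nilpotency of the adjoint action of square-zero matrices -/

theorem evenAct_single (k : Fin 3) (N : SL2) (u : Odd) (s : Fin 3 → Fin 2) :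
    evenAct (Pi.single k N) u s =
      ∑ j : Fin 2, (N : Matrix (Fin 2) (Fin 2) ℂ) (s k) j * u (Function.update s k j) := by
  rw [evenAct, Finset.sum_eq_single k]
  · simp
  · intro b _ hb; simp [hb]
  · simp

/-- N acts through the k-th tensor factor only, where its square is zero. -/
theorem evenAct_single_single (k : Fin 3) {N : SL2}
    (hN : (N : Matrix (Fin 2) (Fin 2) ℂ) * N = 0) (u : Odd) :
    evenAct (Pi.single k N) (evenAct (Pi.single k N) u) = 0 := by
  funext s
  have h : ∀ i j, (N : Matrix (Fin 2) (Fin 2) ℂ) i 0 * (N : Matrix (Fin 2) (Fin 2) ℂ) 0 j +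
      (N : Matrix (Fin 2) (Fin 2) ℂ) i 1 * (N : Matrix (Fin 2) (Fin 2) ℂ) 1 j = 0 := fun i j => by
    simpa [Matrix.mul_apply, Fin.sum_univ_two] using congrFun (congrFun hN i) j
  simp only [evenAct_single, Fin.sum_univ_two, Function.update_self, Function.update_idem,
    Pi.zero_apply]
  linear_combination u (Function.update s k 0) * h (s k) 0 + u (Function.update s k 1) * h (s k) 1

theorem bracket_evenG (a : ℂ) (k : Fin 3) (N : SL2) (u : G) :
    bracket a (evenG k N) u = (Pi.single k ⁅N, u.1 k⁆, evenAct (Pi.single k N) u.2) := by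
  ext1
  · funext i
    by_cases h : i = k
    · subst h; simp [bracket, evenG]
    · simp [bracket, evenG, h]
  · simp [bracket, evenG]

/-- The triple commutator expands into products of three N and one M, each with two adjacent factors
N. -/
theorem lie_lie_lie_eq_zero {N : SL2} (hN : (N : Matrix (Fin 2) (Fin 2) ℂ) * N = 0) (M : SL2) :
    ⁅N, ⁅N, ⁅N, M⁆⁆⁆ = 0 := by
  ext1
  simp only [coe_lie, ZeroMemClass.coe_zero]
  generalize (N : Matrix (Fin 2) (Fin 2) ℂ) = A at *
  have h1 : ∀ B, A * (A * B) = 0 := fun B => by rw [← mul_assoc, hN, zero_mul]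
  simp [mul_sub, sub_mul, mul_assoc, h1, hN]

theorem trace_mul_lie_lie {N : SL2} (hN : (N : Matrix (Fin 2) (Fin 2) ℂ) * N = 0) (M : SL2) :
    ((N : Matrix (Fin 2) (Fin 2) ℂ) * (⁅N, ⁅N, M⁆⁆ : SL2)).trace = 0 := by
  simp only [coe_lie]
  generalize (N : Matrix (Fin 2) (Fin 2) ℂ) = A at *
  have h1 : ∀ B, A * (A * B) = 0 := fun B => by rw [← mul_assoc, hN, zero_mul]
  simp [mul_sub, sub_mul, mul_assoc, h1, hN]

theorem form_evenG (a : ℂ) (k : Fin 3) (N : SL2) (u : G) :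
    form a (evenG k N) u = (sigma a k)⁻¹ *
      ((N : Matrix (Fin 2) (Fin 2) ℂ) * (u.1 k : Matrix (Fin 2) (Fin 2) ℂ)).trace := by
  simp only [form, evenG]
  rw [Finset.sum_eq_single k]
  · simp
  · intro b _ hb; simp [hb]
  · simp

theorem trace_mul_lie {N : SL2} (hN : (N : Matrix (Fin 2) (Fin 2) ℂ) * N = 0) (M : SL2) :
    ((N : Matrix (Fin 2) (Fin 2) ℂ) * (⁅N, M⁆ : SL2)).trace = 0 := by
  simp only [coe_lie]
  generalize (N : Matrix (Fin 2) (Fin 2) ℂ) = A at *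
  rw [mul_sub, ← mul_assoc, hN, Matrix.trace_sub, Matrix.trace_mul_comm A, mul_assoc, hN]
  simp

theorem affBracket_loop_loop_add_central (a : ℂ) (m n : ℤ) (u w : G) (c : ℂ) :
    affBracket a (loop m u) (Finsupp.single n w, c, 0) = affBracket a (loop m u) (loop n w) := by
  simp [affBracket, loop]

/-- The loop part dies because N² = 0. A central term from the first bracket is killed by the
second; the later cocycle terms pair N with an iterated bracket of N, and those traces vanish. -/
theorem affBracket_evenG_thrice {N : SL2} (hN : (N : Matrix (Fin 2) (Fin 2) ℂ) * N = 0)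
    (a : ℂ) (k : Fin 3) (m n : ℤ) (u : G) :
    affBracket a (loop m (evenG k N)) (affBracket a (loop m (evenG k N))
      (affBracket a (loop m (evenG k N)) (loop n u))) = 0 := by
  rw [affBracket_loop a m n, affBracket_loop_loop_add_central,
    affBracket_loop_of_form_eq_zero, affBracket_loop_of_form_eq_zero]
  · simp only [bracket_evenG, evenAct_single_single k hN, Pi.single_eq_same,
      lie_lie_lie_eq_zero hN, evenAct_zero_right, Pi.single_zero]
    simp [loop]
  · simp only [bracket_evenG, form_evenG, Pi.single_eq_same, trace_mul_lie_lie hN, mul_zero]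
  · simp only [bracket_evenG, form_evenG, Pi.single_eq_same, trace_mul_lie hN, mul_zero]

/-! ### Brackets of odd basis vectors -/

/-- The opposite basis vector. -/
def flip (s : Fin 3 → Fin 2) : Fin 3 → Fin 2 := fun i => s i + 1

theorem oddBracket_single (a : ℂ) (s t : Fin 3 → Fin 2) (i : Fin 3) :
    oddBracket a (Pi.single s 1) (Pi.single t 1) i =
      (sigma a i * ∏ j ∈ Finset.univ.erase i, psi (s j) (t j)) • p (s i) (t i) := by
  rw [oddBracket, Finset.sum_eq_single s, Finset.sum_eq_single t]
  · simp
  · intro b _ hb; simp [hb]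
  · simp
  · intro b _ hb; simp [hb]
  · simp

theorem form_oddG (a : ℂ) (s t : Fin 3 → Fin 2) :
    form a (oddG s) (oddG t) = -2 * ∏ j : Fin 3, psi (s j) (t j) := by
  rw [form, Finset.sum_eq_single (a := s), Finset.sum_eq_single (a := t)]
  · simp [oddG]
  · intro b _ hb; simp [oddG, hb]
  · simp
  · intro b _ hb; simp [oddG, hb]
  · simp

theorem psi_self (b : Fin 2) : psi b b = 0 := by fin_cases b <;> simp [psi]

theorem psi_flip (b : Fin 2) : psi b (b + 1) = sgn b := by fin_cases b <;> simp [psi, sgn]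

theorem p_flip (b : Fin 2) : p b (b + 1) = (-1 : ℂ) • hSL2 := by
  ext i j
  fin_cases b <;> fin_cases i <;> fin_cases j <;> simp [p, pMat, psi, hSL2]

theorem sgn_mul_self (b : Fin 2) : (sgn b : ℂ) * sgn b = 1 := by
  fin_cases b <;> simp [sgn]

/-- Odd roots are isotropic: ψ(e_b, e_b) = 0, and a product over j ≠ i still contains the factor at
i + 1. -/
theorem affBracket_oddG_self (a : ℂ) (n : ℤ) (s : Fin 3 → Fin 2) :
    affBracket a (loop n (oddG s)) (loop n (oddG s)) = 0 := by
  have h : ∀ i : Fin 3, ∏ j ∈ Finset.univ.erase i, psi (s j) (s j) = 0 := fun i =>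
    Finset.prod_eq_zero (i := i + 1) (by fin_cases i <;> simp) (psi_self _)
  have h1 : bracket a (oddG s) (oddG s) = 0 := by
    ext1
    · funext i
      have : oddBracket a (Pi.single s 1) (Pi.single s 1) i = 0 := by
        rw [oddBracket_single, h]; simp
      simp [bracket, oddG, this]
    · simp [bracket, oddG]
  rw [affBracket_loop_of_form_eq_zero, h1]
  · simp [loop]
  · rw [form_oddG, Finset.prod_eq_zero (i := 0) (by simp) (psi_self (s 0)), mul_zero]

/-- Up to the non-zero scalar -2 ∏ sgn, the right side is the image of the odd root under
`toCartan`; for a simple root, the vanishing of Λ on it is therefore the condition m_i = 0. -/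
theorem affBracket_oddG_flip (a : ℂ) (n : ℤ) (s : Fin 3 → Fin 2) :
    affBracket a (loop n (oddG s)) (loop (-n) (oddG (flip s))) =
      cartan ((-2 * ∏ j : Fin 3, (sgn (s j) : ℂ)) •
        ((fun i => sigma a i / 2 * sgn (s i), (n : ℂ), 0) : Cartan)) := by
  rw [affBracket_loop, form_oddG]
  ext1
  · simp only [add_neg_cancel, cartan]
    congr 1
    ext1
    · funext i
      have : oddBracket a (Pi.single s 1) (Pi.single (flip s) 1) i =
          (-2 * (∏ j : Fin 3, (sgn (s j) : ℂ)) * (sigma a i / 2 * sgn (s i))) • hSL2 := by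
        rw [oddBracket_single]
        simp only [flip, p_flip, psi_flip, smul_smul]
        congr 1
        rw [← Finset.mul_prod_erase Finset.univ (fun j => (sgn (s j) : ℂ)) (Finset.mem_univ i)]
        linear_combination (sigma a i * (∏ j ∈ Finset.univ.erase i, (sgn (s j) : ℂ))) *
          sgn_mul_self (s i)
      simp [bracket, oddG, this]
    · simp [bracket, oddG]
  · simp only [cartan, flip, psi_flip]
    ext1
    · simp; ring
    · simp

/-! ### Roots in coordinates with respect to the simple roots -/

/-- The weight with the given coordinates. -/
def wt (c : Fin 4 → ℤ) : Weight := ∑ i, c i • simpleRoot i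

/-- The pairing of coordinate vectors. -/
def dot (c q : Fin 4 → ℤ) : ℤ := ∑ i, c i * q i

/-- The coordinates of the roots: the non-zero vectors whose entries differ by at most one. -/
def IsRoot (c : Fin 4 → ℤ) : Prop := c ≠ 0 ∧ ∀ k l, c k ≤ c l + 1

/-- An element of the Cartan subalgebra with prescribed values on the simple roots. -/
def coweight (q : Fin 4 → ℤ) : Cartan :=
  (![(q 2 + q 3) / 2, (q 1 + q 3) / 2, (q 1 + q 2) / 2], 0, q 0 + q 1 + q 2 + q 3)

theorem wt_apply (c : Fin 4 → ℤ) (h : Cartan) :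
    wt c h = (c 2 + c 3 - c 0 - c 1) * h.1 0 + (c 1 + c 3 - c 0 - c 2) * h.1 1 +
      (c 1 + c 2 - c 0 - c 3) * h.1 2 + c 0 * h.2.2 := by
  simp [wt, Fin.sum_univ_four, simpleRoot, eps, delta]
  ring

theorem wt_coweight (c q : Fin 4 → ℤ) : wt c (coweight q) = dot c q := by
  rw [wt_apply]
  simp [coweight, dot, Fin.sum_univ_four]
  ring

theorem wt_add (c d : Fin 4 → ℤ) : wt (c + d) = wt c + wt d := by
  simp [wt, add_smul, Finset.sum_add_distrib]

theorem wt_neg (c : Fin 4 → ℤ) : wt (-c) = -wt c := by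
  simp [wt]

theorem wt_single (i : Fin 4) : wt (Pi.single i 1) = simpleRoot i := by
  rw [wt, Finset.sum_eq_single i]
  · simp
  · intro b _ hb; simp [hb]
  · simp

/-- Evaluation on the fundamental coweight `coweight (Pi.single i 1)` reads off the i-th coordinate.
-/
theorem wt_injective : Function.Injective wt := by
  intro c d h
  funext i
  have := congrArg (fun γ : Weight => γ (coweight (Pi.single i 1))) h
  simp only [wt_coweight] at this
  simpa [dot, Pi.single_apply] using this

theorem IsRoot.neg {c : Fin 4 → ℤ} (h : IsRoot c) : IsRoot (-c) :=
  ⟨neg_ne_zero.2 h.1, fun k l => by have := h.2 l k; simp only [Pi.neg_apply]; omega⟩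

/-- The elements of the root space with coordinates `c` that are homogeneous for the parity. -/
def rootVectors (a : ℂ) (c : Fin 4 → ℤ) : Set Aff :=
  {x | x ∈ rootSpace a (wt c) ∧ ∃ i : ZMod 2, x ∈ parity i}

theorem loop_mem_rootSpace {a : ℂ} {γ : Weight} {n : ℤ} {u : G}
    (h : ∀ h : Cartan, bracket a (cartanG h) u = (γ h - h.2.2 * n) • u) :
    loop n u ∈ rootSpace a γ := by
  intro x
  refine Prod.ext ?_ ?_
  · ext1 m
    rw [affBracket_cartan_fst]
    simp only [loop, Prod.smul_fst, Finsupp.smul_apply, Finsupp.single_apply]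
    split_ifs with hm
    · subst hm
      rw [h, ← add_smul, sub_add_cancel]
    · simp
  · rw [affBracket_cartan_snd, Prod.smul_snd]
    exact (smul_zero _).symm

theorem loop_evenG_mem_parity (n : ℤ) (k : Fin 3) (N : SL2) : loop n (evenG k N) ∈ parity 0 := by
  intro m
  by_cases h : n = m <;> simp [loop, evenG, h]

theorem loop_oddG_mem_parity (n : ℤ) (s : Fin 3 → Fin 2) : loop n (oddG s) ∈ parity 1 := by
  rw [parity, if_neg (by decide)]
  refine ⟨fun m => ?_, rfl⟩
  by_cases h : n = m <;> simp [loop, oddG, h]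

theorem cartan_mem_parity (h : Cartan) : cartan h ∈ parity 0 := by
  intro m
  by_cases h : 0 = m <;> simp [cartan, h]

theorem bracket_cartanG_evenG (a : ℂ) (h : Cartan) (k : Fin 3) (N : SL2) :
    bracket a (cartanG h) (evenG k N) = evenG k (h.1 k • ⁅hSL2, N⁆) := by
  ext1
  · funext i
    by_cases hi : i = k
    · subst hi; simp [bracket, evenG, cartanG]
    · simp [bracket, evenG, hi]
  · simp [bracket, evenG, cartanG]

theorem evenG_smul (k : Fin 3) (c : ℂ) (N : SL2) : evenG k (c • N) = c • evenG k N := by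
  ext1 <;> simp [evenG, Pi.single_smul]

/-- The coordinates of `2 ε_k`. -/
def evenRoot (k : Fin 3) : Fin 4 → ℤ := ![![0, 0, 1, 1], ![0, 1, 0, 1], ![0, 1, 1, 0]] k

/-- The coordinates of `± ε_0 ± ε_1 ± ε_2`, with the signs given by `s`. -/
def oddRoot (s : Fin 3 → Fin 2) : Fin 4 → ℤ :=
  ![0, 1 - (s 1).val - (s 2).val, 1 - (s 0).val - (s 2).val, 1 - (s 0).val - (s 1).val]

/-- The coordinates of `n δ`. -/
def imRoot (n : ℤ) : Fin 4 → ℤ := fun _ => n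

theorem wt_evenRoot (k : Fin 3) (h : Cartan) : wt (evenRoot k) h = 2 * h.1 k := by
  rw [wt_apply]; fin_cases k <;> simp [evenRoot] <;> norm_num

theorem sgn_eq (b : Fin 2) : sgn b = 1 - 2 * (b.val : ℤ) := by fin_cases b <;> simp [sgn]

theorem wt_oddRoot (s : Fin 3 → Fin 2) (h : Cartan) :
    wt (oddRoot s) h = ∑ i, h.1 i * sgn (s i) := by
  rw [wt_apply]
  simp only [oddRoot, sgn_eq, Fin.sum_univ_three]
  simp
  ring

theorem wt_imRoot (n : ℤ) (h : Cartan) : wt (imRoot n) h = h.2.2 * n := by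
  rw [wt_apply]; simp [imRoot]; ring

theorem loop_eSL2_mem (a : ℂ) (n : ℤ) (k : Fin 3) :
    loop n (evenG k eSL2) ∈ rootSpace a (wt (evenRoot k + imRoot n)) :=
  loop_mem_rootSpace fun h => by
    rw [bracket_cartanG_evenG, lie_hSL2_eSL2, wt_add, LinearMap.add_apply, wt_evenRoot, wt_imRoot,
      smul_smul, evenG_smul]
    congr 1; ring

theorem loop_fSL2_mem (a : ℂ) (n : ℤ) (k : Fin 3) :
    loop n (evenG k fSL2) ∈ rootSpace a (wt (-evenRoot k + imRoot n)) :=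
  loop_mem_rootSpace fun h => by
    rw [bracket_cartanG_evenG, lie_hSL2_fSL2, wt_add, LinearMap.add_apply, wt_neg,
      LinearMap.neg_apply, wt_evenRoot, wt_imRoot, smul_smul, evenG_smul]
    congr 1; ring

theorem loop_hSL2_mem (a : ℂ) (n : ℤ) (k : Fin 3) :
    loop n (evenG k hSL2) ∈ rootSpace a (wt (imRoot n)) :=
  loop_mem_rootSpace fun h => by
    rw [bracket_cartanG_evenG, lie_self, smul_zero, wt_imRoot, sub_self, zero_smul]
    simp [evenG]

theorem loop_oddG_mem (a : ℂ) (n : ℤ) (s : Fin 3 → Fin 2) :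
    loop n (oddG s) ∈ rootSpace a (wt (oddRoot s + imRoot n)) :=
  loop_mem_rootSpace fun h => by
    rw [wt_add, LinearMap.add_apply, wt_imRoot, wt_oddRoot, add_sub_cancel_right]
    ext1
    · funext i
      simp [bracket, oddG, cartanG]
    · funext t
      rw [bracket_cartanG_snd]
      simp only [oddG, Prod.smul_snd, Pi.smul_apply, smul_eq_mul]
      by_cases ht : t = s
      · rw [ht]
      · simp [ht]

theorem isRoot_evenRoot (k : Fin 3) (n : ℤ) : IsRoot (evenRoot k + imRoot n) := by
  refine ⟨fun h => ?_, fun i j => ?_⟩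
  · have h1 := congrFun h 1
    have h2 := congrFun h 2
    have h3 := congrFun h 3
    fin_cases k <;> simp [evenRoot, imRoot] at h1 h2 h3 <;> omega
  · fin_cases k <;> fin_cases i <;> fin_cases j <;> simp [evenRoot, imRoot] <;> omega

theorem isRoot_oddRoot (s : Fin 3 → Fin 2) (n : ℤ) : IsRoot (oddRoot s + imRoot n) := by
  have h0 := (s 0).isLt
  have h1 := (s 1).isLt
  have h2 := (s 2).isLt
  refine ⟨fun h => ?_, fun i j => ?_⟩
  · have h3 := congrFun h 0
    have h4 := congrFun h 1
    have h5 := congrFun h 2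
    have h6 := congrFun h 3
    simp [oddRoot, imRoot] at h3 h4 h5 h6
    omega
  · fin_cases i <;> fin_cases j <;> simp [oddRoot, imRoot] <;> omega

theorem isRoot_imRoot {n : ℤ} (hn : n ≠ 0) : IsRoot (imRoot n) :=
  ⟨fun h => hn (congrFun h 0), fun i j => by simp [imRoot]⟩

/-- The Cartan subalgebra and the homogeneous root vectors. -/
def generators (a : ℂ) : Set Aff :=
  Set.range cartan ∪ {x | ∃ c, IsRoot c ∧ x ∈ rootVectors a c}

theorem evenG_decomp (k : Fin 3) (N : SL2) :
    evenG k N = (N : Matrix (Fin 2) (Fin 2) ℂ) 0 1 • evenG k eSL2 +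
      (N : Matrix (Fin 2) (Fin 2) ℂ) 1 0 • evenG k fSL2 +
      (N : Matrix (Fin 2) (Fin 2) ℂ) 0 0 • evenG k hSL2 := by
  have h : (N : Matrix (Fin 2) (Fin 2) ℂ).trace = 0 := N.2
  rw [Matrix.trace_fin_two] at h
  have h1 : N = (N : Matrix (Fin 2) (Fin 2) ℂ) 0 1 • eSL2 +
      (N : Matrix (Fin 2) (Fin 2) ℂ) 1 0 • fSL2 +
      (N : Matrix (Fin 2) (Fin 2) ℂ) 0 0 • hSL2 := by
    ext i j
    fin_cases i <;> fin_cases j <;> simp [eSL2, fSL2, hSL2]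
    linear_combination h
  conv_lhs => rw [h1]
  simp only [← evenG_smul]
  ext1
  · simp [evenG, Pi.single_add]
  · simp [evenG]

theorem G_decomp (u : G) : u = ∑ k, evenG k (u.1 k) + ∑ s, u.2 s • oddG s := by
  ext1
  · simp only [Prod.fst_add, Prod.fst_sum, evenG, oddG, Prod.smul_fst, smul_zero,
      Finset.sum_const_zero, add_zero]
    exact (Finset.univ_sum_single u.1).symm
  · simp only [Prod.snd_add, Prod.snd_sum, evenG, oddG, Prod.smul_snd,
      Finset.sum_const_zero, zero_add]
    funext t
    simp [Finset.sum_apply, Pi.single_apply]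

/-- `u ↦ u t^n` as a linear map. -/
def loopHom (n : ℤ) : G →ₗ[ℂ] Aff where
  toFun := loop n
  map_add' u w := by simp [loop]
  map_smul' c u := by simp [loop]

/-- Reduces statements about the whole algebra to the Cartan subalgebra and homogeneous root
vectors. Degree-zero diagonal elements lie in the Cartan subalgebra; in other degrees they are root
vectors for nδ. -/
theorem span_generators (a : ℂ) : Submodule.span ℂ (generators a) = ⊤ := by
  have hc : ∀ h, cartan h ∈ Submodule.span ℂ (generators a) := fun h =>
    Submodule.subset_span (Or.inl ⟨h, rfl⟩)
  have hr : ∀ c x, IsRoot c → x ∈ rootVectors a c → x ∈ Submodule.span ℂ (generators a) :=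
    fun c x h1 h2 => Submodule.subset_span (Or.inr ⟨c, h1, h2⟩)
  have hh : ∀ n k, loop n (evenG k hSL2) ∈ Submodule.span ℂ (generators a) := by
    intro n k
    by_cases hn : n = 0
    · convert hc (cartanH k) using 1
      subst hn
      simp only [loop, evenG, cartan, cartanH]
      congr 3
      funext i
      by_cases hi : i = k
      · subst hi; simp
      · simp [hi]
    · exact hr _ _ (isRoot_imRoot hn) ⟨loop_hSL2_mem a n k, 0, loop_evenG_mem_parity _ _ _⟩
  have hl : ∀ n u, loopHom n u ∈ Submodule.span ℂ (generators a) := by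
    intro n u
    rw [G_decomp u, map_add, map_sum, map_sum]
    refine add_mem (sum_mem fun k _ => ?_) (sum_mem fun s _ => ?_)
    · rw [evenG_decomp, map_add, map_add, map_smul, map_smul, map_smul]
      refine add_mem (add_mem (Submodule.smul_mem _ _ ?_) (Submodule.smul_mem _ _ ?_))
        (Submodule.smul_mem _ _ (hh n k))
      · exact hr _ _ (isRoot_evenRoot k n) ⟨loop_eSL2_mem a n k, 0, loop_evenG_mem_parity _ _ _⟩
      · refine hr _ _ ?_ ⟨loop_fSL2_mem a n k, 0, loop_evenG_mem_parity _ _ _⟩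
        have := (isRoot_evenRoot k (-n)).neg
        convert this using 1
        funext i
        simp [imRoot]
        ring
    · rw [map_smul]
      exact Submodule.smul_mem _ _
        (hr _ _ (isRoot_oddRoot s n) ⟨loop_oddG_mem a n s, 1, loop_oddG_mem_parity _ _⟩)
  rw [eq_top_iff]
  rintro ⟨x, b, c⟩ -
  have h1 : ((x, b, c) : Aff) = (x, 0, 0) + cartan (0, b, c) := by
    simp [cartan, show ((fun _ => 0, 0) : G) = 0 from rfl]
  rw [h1]
  refine add_mem ?_ (hc _)
  clear h1
  induction x using Finsupp.induction_linear with
  | zero => exact zero_mem _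
  | add f g hf hg =>
    have : ((f + g, 0, 0) : Aff) = (f, 0, 0) + (g, 0, 0) := by simp
    rw [this]
    exact add_mem hf hg
  | single n u => exact hl n u

/-! ### Weights, singular vectors and spans of negative words -/

namespace Rep

variable {a : ℂ} {V : Type*} [AddCommGroup V] [Module ℂ V] (ρ : Rep a V)

theorem act_bracket_even {x y : Aff} {j : ZMod 2} (hx : x ∈ parity 0) (hy : y ∈ parity j) :
    ρ.act (affBracket a x y) = ρ.act x * ρ.act y - ρ.act y * ρ.act x := by
  rw [ρ.act_bracket 0 j x hx y hy]; simp

theorem act_bracket_odd {x y : Aff} (hx : x ∈ parity 1) (hy : y ∈ parity 1) :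
    ρ.act (affBracket a x y) = ρ.act x * ρ.act y + ρ.act y * ρ.act x := by
  rw [ρ.act_bracket 1 1 x hx y hy, show (1 : ZMod 2).val = 1 from rfl]; simp

theorem act_cartan_act {x : Aff} {γ : Weight} {j : ZMod 2} (hx : x ∈ rootSpace a γ)
    (hj : x ∈ parity j) (h : Cartan) (v : V) :
    ρ.act (cartan h) (ρ.act x v) = ρ.act x (ρ.act (cartan h) v) + γ h • ρ.act x v := by
  have h1 := ρ.act_bracket_even (cartan_mem_parity h) hj
  rw [hx h, map_smul] at h1
  have h2 := LinearMap.congr_fun h1 v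
  simp only [LinearMap.smul_apply, LinearMap.sub_apply, Module.End.mul_apply] at h2
  rw [h2]; abel

/-- `v` has weight `μ`. -/
def HasWeight (μ : Weight) (v : V) : Prop := ∀ h : Cartan, ρ.act (cartan h) v = μ h • v

variable {ρ} in
theorem HasWeight.act {μ γ : Weight} {v : V} (hv : ρ.HasWeight μ v) {x : Aff} {j : ZMod 2}
    (hx : x ∈ rootSpace a γ) (hj : x ∈ parity j) : ρ.HasWeight (μ + γ) (ρ.act x v) := fun h => by
  rw [ρ.act_cartan_act hx hj, hv h, map_smul, LinearMap.add_apply, add_smul]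

/-- `v` is a homogeneous vector of weight `μ` killed by the root vectors that are positive with
respect to the height function `p`. -/
structure IsSingular (p : Fin 4 → ℤ) (μ : Weight) (v : V) : Prop where
  homogeneous : ∃ j, v ∈ ρ.grading j
  hasWeight : ρ.HasWeight μ v
  act_eq_zero : ∀ c, IsRoot c → 0 < dot c p → ∀ x ∈ rootVectors a c, ρ.act x v = 0

/-- Products of `p`-negative root vectors applied to `v`, with the coordinates of the weight of the
product and the parity of the result. -/
inductive Word (p : Fin 4 → ℤ) (v : V) : (Fin 4 → ℤ) → ZMod 2 → V → Prop
  | nil {j : ZMod 2} (hv : v ∈ ρ.grading j) : Word p v 0 j v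
  | cons {c d : Fin 4 → ℤ} {i j : ZMod 2} {x : Aff} {w : V} (hc : IsRoot c) (hp : dot c p < 0)
      (hx : x ∈ rootSpace a (wt c)) (hi : x ∈ parity i) (hw : Word p v d j w) :
      Word p v (d + c) (i + j) (ρ.act x w)

/-- The span of all products of `p`-negative root vectors applied to `v`. -/
def wordSpan (p : Fin 4 → ℤ) (v : V) : Submodule ℂ V :=
  Submodule.span ℂ {w | ∃ d j, ρ.Word p v d j w}

variable {ρ}

theorem dot_add (c d q : Fin 4 → ℤ) : dot (c + d) q = dot c q + dot d q := by
  simp [dot, add_mul, Finset.sum_add_distrib]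

theorem Word.mem_grading {p d : Fin 4 → ℤ} {v w : V} {j : ZMod 2} (h : ρ.Word p v d j w) :
    w ∈ ρ.grading j := by
  induction h with
  | nil hv => exact hv
  | cons _ _ _ hi _ ih => exact ρ.act_mem _ _ _ hi _ ih

theorem Word.hasWeight {p d : Fin 4 → ℤ} {v w : V} {j : ZMod 2} (h : ρ.Word p v d j w) {μ : Weight}
    (hv : ρ.HasWeight μ v) : ρ.HasWeight (μ + wt d) w := by
  induction h with
  | nil _ => simpa [wt] using hv
  | cons _ _ hx hi _ ih => rw [wt_add, ← add_assoc]; exact ih.act hx hi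

theorem Word.dot_nonpos {p q d : Fin 4 → ℤ} (hq : ∀ c, IsRoot c → dot c p < 0 → dot c q ≤ 0)
    {v w : V} {j : ZMod 2} (h : ρ.Word p v d j w) : dot d q ≤ 0 := by
  induction h with
  | nil _ => simp [dot]
  | cons hc hp _ _ _ ih => rw [dot_add]; have := hq _ hc hp; omega

theorem act_mem_wordSpan_of_neg {p c : Fin 4 → ℤ} {v w : V} {x : Aff} (hc : IsRoot c)
    (hp : dot c p < 0) (hx : x ∈ rootVectors a c) (hw : w ∈ ρ.wordSpan p v) :
    ρ.act x w ∈ ρ.wordSpan p v := by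
  obtain ⟨hx, i, hi⟩ := hx
  have : ρ.wordSpan p v ≤ (ρ.wordSpan p v).comap (ρ.act x) := by
    refine Submodule.span_le.2 ?_
    rintro w ⟨d, j, hw⟩
    exact Submodule.subset_span ⟨_, _, Word.cons hc hp hx hi hw⟩
  exact this hw

/-- A subspace stable under the generators is stable under the whole algebra. -/
theorem act_mem_of_generators {S : Submodule ℂ V} {w : V}
    (h : ∀ x ∈ generators a, ρ.act x w ∈ S) (x : Aff) : ρ.act x w ∈ S := by
  have h1 : Submodule.span ℂ (generators a) ≤
      S.comap ((LinearMap.applyₗ w : Module.End ℂ V →ₗ[ℂ] V) ∘ₗ ρ.act) :=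
    Submodule.span_le.2 h
  rw [span_generators] at h1
  exact h1 (Submodule.mem_top (x := x))

/-- Induction on the word through x y w = [x, y] w ± y x w. The claim is carried for all x at once,
since [x, y] need not be a single generator. -/
theorem Word.act_mem {p d : Fin 4 → ℤ} (hp : ∀ c, IsRoot c → dot c p ≠ 0) {μ : Weight} {v w : V}
    (hv : ρ.IsSingular p μ v) {j : ZMod 2} (h : ρ.Word p v d j w) (x : Aff) :
    ρ.act x w ∈ ρ.wordSpan p v := by
  induction h generalizing x with
  | nil hj =>
    refine act_mem_of_generators ?_ x
    rintro x (⟨h, rfl⟩ | ⟨c, hc, hx⟩)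
    · rw [hv.hasWeight h]
      exact Submodule.smul_mem _ _ (Submodule.subset_span ⟨_, _, Word.nil hj⟩)
    · rcases lt_or_gt_of_ne (hp c hc) with h | h
      · exact act_mem_wordSpan_of_neg hc h hx (Submodule.subset_span ⟨_, _, Word.nil hj⟩)
      · rw [hv.act_eq_zero c hc h x hx]
        exact zero_mem _
  | @cons c d i j y w hc hpc hy hi hw ih =>
    refine act_mem_of_generators (fun x hx => ?_) x
    have hx' : ∃ i, x ∈ parity i := by
      rcases hx with ⟨h, rfl⟩ | ⟨c, hc, hx⟩
      · exact ⟨0, cartan_mem_parity h⟩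
      · exact hx.2
    obtain ⟨i', hi'⟩ := hx'
    have h1 := LinearMap.congr_fun (ρ.act_bracket i' i x hi' y hi) w
    simp only [LinearMap.smul_apply, LinearMap.sub_apply, Module.End.mul_apply] at h1
    rw [sub_eq_iff_eq_add.1 h1.symm]
    exact add_mem (ih _)
      (Submodule.smul_mem _ _ (act_mem_wordSpan_of_neg hc hpc ⟨hy, i, hi⟩ (ih x)))

theorem act_mem_wordSpan {p : Fin 4 → ℤ} (hp : ∀ c, IsRoot c → dot c p ≠ 0) {μ : Weight} {v w : V}
    (hv : ρ.IsSingular p μ v) (x : Aff) (hw : w ∈ ρ.wordSpan p v) :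
    ρ.act x w ∈ ρ.wordSpan p v := by
  have : ρ.wordSpan p v ≤ (ρ.wordSpan p v).comap (ρ.act x) :=
    Submodule.span_le.2 fun w ⟨_, _, hw⟩ => hw.act_mem hp hv x
  exact this hw

/-- Irreducibility only tests graded subspaces; this makes spans of homogeneous vectors admissible.
-/
theorem eq_sup_of_span {s : Set V} (hs : ∀ w ∈ s, ∃ j, w ∈ ρ.grading j) :
    Submodule.span ℂ s =
      (Submodule.span ℂ s ⊓ ρ.grading 0) ⊔ (Submodule.span ℂ s ⊓ ρ.grading 1) := by
  refine le_antisymm (Submodule.span_le.2 fun w hw => ?_) (sup_le inf_le_left inf_le_left)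
  obtain ⟨j, hj⟩ := hs w hw
  have hj' : j = 0 ∨ j = 1 := (by decide : ∀ j : ZMod 2, j = 0 ∨ j = 1) j
  rcases hj' with rfl | rfl
  · exact Submodule.mem_sup_left ⟨Submodule.subset_span hw, hj⟩
  · exact Submodule.mem_sup_right ⟨Submodule.subset_span hw, hj⟩

theorem wordSpan_eq_top (hρ : ρ.IsIrreducible) {p : Fin 4 → ℤ} (hp : ∀ c, IsRoot c → dot c p ≠ 0)
    {μ : Weight} {v : V} (hv : ρ.IsSingular p μ v) (hv0 : v ≠ 0) : ρ.wordSpan p v = ⊤ := by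
  refine (hρ.2 (ρ.wordSpan p v) (fun x w hw => act_mem_wordSpan hp hv x hw)
    (eq_sup_of_span fun w ⟨_, j, hw⟩ => ⟨j, hw.mem_grading⟩)).resolve_left fun h => hv0 ?_
  obtain ⟨j, hj⟩ := hv.homogeneous
  have : v ∈ ρ.wordSpan p v := Submodule.subset_span ⟨_, _, Word.nil hj⟩
  rwa [h, Submodule.mem_bot] at this

/-- The weights of an irreducible module with singular vector `v`, measured by a coweight that is
nonpositive on the negative roots. -/
theorem exists_nat_of_hasWeight (hρ : ρ.IsIrreducible) {p q : Fin 4 → ℤ}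
    (hp : ∀ c, IsRoot c → dot c p ≠ 0) (hq : ∀ c, IsRoot c → dot c p < 0 → dot c q ≤ 0)
    {μ : Weight} {v : V} (hv : ρ.IsSingular p μ v) (hv0 : v ≠ 0) {ν : Weight} {w : V} (hw0 : w ≠ 0)
    (hw : ρ.HasWeight ν w) : ∃ n : ℕ, ν (coweight q) = μ (coweight q) - n := by
  by_contra! hn
  set Q := ρ.act (cartan (coweight q))
  -- Otherwise every word lies in an eigenspace of `Q` for an eigenvalue other than that of w.
  -- Eigenspaces are independent and words span V, so w = 0.
  have h1 : ρ.wordSpan p v ≤ ⨆ z, ⨆ _ : z ≠ ν (coweight q), Q.eigenspace z := by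
    refine Submodule.span_le.2 ?_
    rintro u ⟨d, j, hu⟩
    have h2 := hu.hasWeight hv.hasWeight (coweight q)
    rw [LinearMap.add_apply, wt_coweight] at h2
    obtain ⟨n, h3⟩ := Int.eq_ofNat_of_zero_le (neg_nonneg.2 (hu.dot_nonpos hq))
    have h4 : ((dot d q : ℤ) : ℂ) = -(n : ℂ) := by
      rw [← neg_eq_iff_eq_neg]; exact_mod_cast h3
    rw [h4, ← sub_eq_add_neg] at h2
    exact Submodule.mem_iSup_of_mem _ (Submodule.mem_iSup_of_mem (hn n).symm
      (Module.End.mem_eigenspace_iff.2 h2))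
  rw [wordSpan_eq_top hρ hp hv hv0] at h1
  refine hw0 (Submodule.disjoint_def.1 (Q.eigenspaces_iSupIndep (ν (coweight q))) w
    (Module.End.mem_eigenspace_iff.2 (hw _)) (h1 Submodule.mem_top))

/-- A singular vector of strictly smaller weight vanishes. -/
theorem IsSingular.eq_zero (hρ : ρ.IsIrreducible) {p : Fin 4 → ℤ}
    (hp : ∀ c, IsRoot c → dot c p ≠ 0) {μ ν : Weight} {v u : V} (hv : ρ.HasWeight μ v)
    (hv0 : v ≠ 0) (hu : ρ.IsSingular p ν u) {d : Fin 4 → ℤ} (hd : ν = μ + wt d)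
    (hdp : dot d p < 0) : u = 0 := by
  by_contra hu0
  -- A non-zero u would itself generate the module, so the weight of v would lie below ν, although ν
  -- is strictly below μ.
  obtain ⟨n, hn⟩ := exists_nat_of_hasWeight hρ hp (fun _ _ h => h.le) hu hu0 hv0 hv
  rw [hd, LinearMap.add_apply, wt_coweight] at hn
  have : ((dot d p : ℤ) : ℂ) = ((n : ℤ) : ℂ) := by push_cast; linear_combination -hn
  have := Int.cast_injective this
  omega

/-- A vector whose weight is not below the highest weight vanishes. -/
theorem IsSingular.eq_zero_of_pos (hρ : ρ.IsIrreducible) {p q : Fin 4 → ℤ}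
    (hp : ∀ c, IsRoot c → dot c p ≠ 0) (hq : ∀ c, IsRoot c → dot c p < 0 → dot c q ≤ 0)
    {μ : Weight} {v : V} (hv : ρ.IsSingular p μ v) (hv0 : v ≠ 0) {w : V} {d : Fin 4 → ℤ}
    (hw : ρ.HasWeight (μ + wt d) w) (hd : 0 < dot d q) : w = 0 := by
  by_contra hw0
  obtain ⟨n, hn⟩ := exists_nat_of_hasWeight hρ hp hq hv hv0 hw0 hw
  rw [LinearMap.add_apply, wt_coweight] at hn
  have : ((dot d q : ℤ) : ℂ) = ((-n : ℤ) : ℂ) := by push_cast; linear_combination hn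
  have := Int.cast_injective this
  omega

end Rep

/-! ### Locally nilpotent operators -/

section LocallyNilpotent

variable {V : Type*} [AddCommGroup V] [Module ℂ V]

/-- Local nilpotency of an endomorphism. -/
def LocNilp (f : Module.End ℂ V) : Prop := ∀ v, ∃ n : ℕ, (f ^ n) v = 0

/-- The commutator with `f`. -/
def comm (f x : Module.End ℂ V) : Module.End ℂ V := f * x - x * f

theorem pow_apply_eq_zero_of_le {f : Module.End ℂ V} {v : V} {m n : ℕ} (h : (f ^ m) v = 0)
    (hmn : m ≤ n) : (f ^ n) v = 0 := by
  obtain ⟨k, rfl⟩ := Nat.exists_eq_add_of_le' hmn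
  rw [pow_add, Module.End.mul_apply, h, map_zero]

theorem LocNilp.smul {f : Module.End ℂ V} (hf : LocNilp f) (c : ℂ) : LocNilp (c • f) := fun v => by
  obtain ⟨n, hn⟩ := hf v
  exact ⟨n, by rw [smul_pow, LinearMap.smul_apply, hn, smul_zero]⟩

/-- By Leibniz, f^N x is a combination of the (ad f)^j(x) f^(N-j); for N = n + k each term has j ≥ k
or N - j ≥ n. -/
theorem pow_apply_apply_eq_zero (f : Module.End ℂ V) {k n : ℕ} {x : Module.End ℂ V} {w : V}
    (hx : (comm f)^[k] x = 0) (hw : (f ^ n) w = 0) : (f ^ (n + k)) (x w) = 0 := by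
  induction hN : n + k generalizing n k x w with
  | zero =>
    obtain ⟨rfl, rfl⟩ : n = 0 ∧ k = 0 := by omega
    simp_all
  | succ N ih =>
    rcases n with _ | n
    · have : w = 0 := by simpa using hw
      rw [this, map_zero, map_zero]
    rcases k with _ | k
    · have : x = 0 := by simpa using hx
      rw [this, LinearMap.zero_apply, map_zero]
    have h1 : f (x w) = x (f w) + comm f x w := by simp [comm]
    rw [pow_succ, Module.End.mul_apply, h1, map_add,
      ih (n := n) (k := k + 1) hx (by rwa [pow_succ, Module.End.mul_apply] at hw) (by omega),
      ih (n := n + 1) (k := k) (by rwa [Function.iterate_succ_apply] at hx) hw (by omega), add_zero]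

theorem comm_mul (f x y : Module.End ℂ V) : comm f (x * y) = comm f x * y + x * comm f y := by
  simp only [comm]; noncomm_ring

theorem comm_add (f x y : Module.End ℂ V) : comm f (x + y) = comm f x + comm f y := by
  simp only [comm]; noncomm_ring

theorem comm_smul (f x : Module.End ℂ V) (c : ℂ) : comm f (c • x) = c • comm f x := by
  simp only [comm, mul_smul_comm, smul_mul_assoc, smul_sub]

/-- The Leibniz rule for the derivation ad f, cut off after three terms because (ad f)³ x = 0; the
coefficients are the binomials of n + 2 over 0, 1, 2. -/
theorem iterate_comm_mul {f x : Module.End ℂ V} (hx : comm f (comm f (comm f x)) = 0)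
    (y : Module.End ℂ V) (n : ℕ) : (comm f)^[n + 2] (x * y) =
      x * (comm f)^[n + 2] y + ((n : ℂ) + 2) • (comm f x * (comm f)^[n + 1] y) +
        (((n : ℂ) + 2) * (n + 1) / 2) • (comm f (comm f x) * (comm f)^[n] y) := by
  induction n with
  | zero =>
    simp only [Function.iterate_succ_apply', Function.iterate_zero, id_eq, comm_mul, comm_add]
    module
  | succ n ih =>
    rw [show n + 1 + 2 = (n + 2) + 1 from rfl, Function.iterate_succ_apply', ih]
    simp only [comm_mul, comm_add, comm_smul, hx, zero_mul, ← Function.iterate_succ_apply' (comm f)]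
    push_cast
    module

/-- Since x has degree at most 2 for ad f, its n-th power has degree at most 2n, with top term the
n-th power of (ad f)² x. The constant is (2n)!/2^n; only its being non-zero matters. -/
theorem iterate_comm_pow {f x : Module.End ℂ V} (hx : comm f (comm f (comm f x)) = 0) (n : ℕ) :
    (comm f)^[2 * n + 1] (x ^ n) = 0 ∧
      ∃ c : ℂ, c ≠ 0 ∧ (comm f)^[2 * n] (x ^ n) = c • comm f (comm f x) ^ n := by
  induction n with
  | zero => exact ⟨by simp [comm], 1, one_ne_zero, by simp⟩
  | succ n ih =>
    obtain ⟨h1, c, hc, h2⟩ := ih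
    have h3 : (comm f)^[2 * n + 2] (x ^ n) = 0 := by
      rw [Function.iterate_succ_apply', h1]; simp [comm]
    have h4 : (comm f)^[2 * n + 3] (x ^ n) = 0 := by
      rw [Function.iterate_succ_apply', h3]; simp [comm]
    refine ⟨?_, ((2 * n : ℕ) + 2) * ((2 * n : ℕ) + 1) / 2 * c, ?_, ?_⟩
    · rw [pow_succ', show 2 * (n + 1) + 1 = (2 * n + 1) + 2 by ring, iterate_comm_mul hx, h1, h4, h3]
      simp
    · refine mul_ne_zero (div_ne_zero (mul_ne_zero ?_ ?_) two_ne_zero) hc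
      · exact_mod_cast Nat.succ_ne_zero (2 * n + 1)
      · exact_mod_cast Nat.succ_ne_zero (2 * n)
    · rw [pow_succ', show 2 * (n + 1) = 2 * n + 2 by ring, iterate_comm_mul hx, h1, h3, h2, pow_succ']
      simp [smul_smul]

/-- The iterated commutator is a combination of the f^i y f^j, and y kills every power of f applied
to w. -/
theorem iterate_comm_apply_eq_zero {f y : Module.End ℂ V} {w : V}
    (h : ∀ b : ℕ, y ((f ^ b) w) = 0) (m : ℕ) (b : ℕ) : (comm f)^[m] y ((f ^ b) w) = 0 := by
  induction m generalizing y b with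
  | zero => exact h b
  | succ m ih =>
    rw [Function.iterate_succ_apply]
    refine ih (fun b => ?_) b
    have := h (b + 1)
    rw [pow_succ', Module.End.mul_apply] at this
    simp [comm, h b, this]

/-- If `f` and `x` are locally nilpotent and `(ad f)^3 x = 0`, then `(ad f)^2 x` is locally
nilpotent: its `n`-th power is proportional to `(ad f)^{2n} (x^n)`. -/
theorem LocNilp.comm_comm {f x : Module.End ℂ V} (hf : LocNilp f) (hxn : LocNilp x)
    (hx : comm f (comm f (comm f x)) = 0) : LocNilp (comm f (comm f x)) := by
  intro w
  obtain ⟨K, hK⟩ := hf w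
  choose N hN using fun b : ℕ => hxn ((f ^ b) w)
  -- Since f^K w = 0, only b < K matters, so one exponent serves all vectors f^b w.
  set M := (Finset.range K).sup N
  have h1 : ∀ b : ℕ, (x ^ M) ((f ^ b) w) = 0 := fun b => by
    rcases lt_or_ge b K with hb | hb
    · exact pow_apply_eq_zero_of_le (hN b) (Finset.le_sup (f := N) (Finset.mem_range.2 hb))
    · rw [pow_apply_eq_zero_of_le hK hb, map_zero]
  obtain ⟨-, c, hc, h2⟩ := iterate_comm_pow hx M
  have h3 := iterate_comm_apply_eq_zero h1 (2 * M) 0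
  rw [h2, LinearMap.smul_apply, pow_zero, Module.End.one_apply] at h3
  exact ⟨M, (smul_eq_zero.1 h3).resolve_left hc⟩

/-! ### Highest weight vectors for `sl₂` -/

theorem sl2_pow {e f h : Module.End ℂ V} (hef : e * f - f * e = h)
    (hhf : h * f - f * h = (-2 : ℂ) • f)
    {v : V} {μ : ℂ} (he : e v = 0) (hv : h v = μ • v) (n : ℕ) :
    h ((f ^ n) v) = (μ - 2 * n) • (f ^ n) v ∧
      e ((f ^ (n + 1)) v) = (((n : ℂ) + 1) * (μ - n)) • (f ^ n) v := by
  have h1 : ∀ w, e (f w) = f (e w) + h w := fun w => by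
    have := LinearMap.congr_fun hef w
    simp only [LinearMap.sub_apply, Module.End.mul_apply] at this
    rw [← this]; abel
  have h2 : ∀ w, h (f w) = f (h w) - (2 : ℂ) • f w := fun w => by
    have := LinearMap.congr_fun hhf w
    simp only [LinearMap.sub_apply, Module.End.mul_apply, LinearMap.smul_apply] at this
    rw [sub_eq_iff_eq_add.1 this]; module
  induction n with
  | zero => simp [h1, he, hv]
  | succ n ih =>
    have h3 : h ((f ^ (n + 1)) v) = (μ - 2 * (n + 1 : ℕ)) • (f ^ (n + 1)) v := by
      rw [pow_succ', Module.End.mul_apply, h2, ih.1, map_smul]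
      push_cast
      module
    refine ⟨h3, ?_⟩
    rw [pow_succ', Module.End.mul_apply, h1, ih.2, h3, map_smul, ← Module.End.mul_apply f,
      ← pow_succ']
    push_cast
    module

/-- At the last non-zero vector f^m v, the coefficient (m + 1)(μ - m) of e f^(m+1) v must vanish. -/
theorem isNat_of_pow_apply_eq_zero {e f h : Module.End ℂ V} (hef : e * f - f * e = h)
    (hhf : h * f - f * h = (-2 : ℂ) • f) {v : V} (hv0 : v ≠ 0) {μ : ℂ} (he : e v = 0)
    (hv : h v = μ • v) {n : ℕ} (hn : (f ^ n) v = 0) : IsNat μ := by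
  classical
  have hex : ∃ n : ℕ, (f ^ n) v = 0 := ⟨n, hn⟩
  rcases hm : Nat.find hex with _ | m
  · have := Nat.find_spec hex
    rw [hm] at this
    exact absurd this hv0
  · have h1 := Nat.find_spec hex
    rw [hm] at h1
    have h2 : (f ^ m) v ≠ 0 := Nat.find_min hex (by omega)
    have h3 := (sl2_pow hef hhf he hv m).2
    rw [h1, map_zero] at h3
    have h4 := (smul_eq_zero.1 h3.symm).resolve_right h2
    have h5 : (m : ℂ) + 1 ≠ 0 := by exact_mod_cast Nat.succ_ne_zero m
    exact ⟨m, sub_eq_zero.1 ((mul_eq_zero.1 h4).resolve_left h5)⟩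

end LocallyNilpotent

/-! ### Spreading local nilpotency over an irreducible module -/

namespace Rep

variable {a : ℂ} {V : Type*} [AddCommGroup V] [Module ℂ V] {ρ : Rep a V}

theorem act_affBracket_eq_comm {x y : Aff} {j : ZMod 2} (hx : x ∈ parity 0) (hy : y ∈ parity j) :
    ρ.act (affBracket a x y) = comm (ρ.act x) (ρ.act y) :=
  ρ.act_bracket_even hx hy

/-- In an irreducible module, an even element with nilpotent adjoint action that acts nilpotently
on one non-zero vector is locally nilpotent. -/
theorem locNilp_of_pow_apply_eq_zero (hρ : ρ.IsIrreducible) {f : Aff} (hf : f ∈ parity 0)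
    (hc : ∀ x ∈ generators a,
      comm (ρ.act f) (comm (ρ.act f) (comm (ρ.act f) (ρ.act x))) = 0)
    {v : V} (hv0 : v ≠ 0) {n : ℕ} (hn : (ρ.act f ^ n) v = 0) : LocNilp (ρ.act f) := by
  let W : Submodule ℂ V :=
    { carrier := {w | ∃ n : ℕ, (ρ.act f ^ n) w = 0}
      zero_mem' := ⟨0, map_zero _⟩
      add_mem' := by
        rintro w w' ⟨n, hn⟩ ⟨n', hn'⟩
        exact ⟨max n n', by rw [map_add, pow_apply_eq_zero_of_le hn (le_max_left _ _),
          pow_apply_eq_zero_of_le hn' (le_max_right _ _), add_zero]⟩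
      smul_mem' := by
        rintro c w ⟨n, hn⟩
        exact ⟨n, by rw [map_smul, hn, smul_zero]⟩ }
  have hpow : ∀ (n : ℕ) (j : ZMod 2), ∀ w ∈ ρ.grading j, (ρ.act f ^ n) w ∈ ρ.grading j := by
    intro n j w hw
    induction n with
    | zero => exact hw
    | succ n ih =>
      rw [pow_succ', Module.End.mul_apply]
      simpa using ρ.act_mem 0 j f hf _ ih
  -- W is invariant because ad f is nilpotent on the generators, and graded because f is even.
  have hW : W = ⊥ ∨ W = ⊤ := by
    refine hρ.2 W (fun x w ⟨n, hn⟩ => ?_) (le_antisymm ?_ (sup_le inf_le_left inf_le_left))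
    · exact act_mem_of_generators (S := W)
        (fun y hy => ⟨n + 3, pow_apply_apply_eq_zero _ (hc y hy) hn⟩) x
    · rintro w ⟨n, hn⟩
      obtain ⟨w0, h0, w1, h1, rfl⟩ := Submodule.mem_sup.1
        (ρ.isCompl_grading.sup_eq_top.ge (Submodule.mem_top (x := w)))
      rw [map_add] at hn
      have h2 : (ρ.act f ^ n) w0 = 0 := by
        refine Submodule.disjoint_def.1 ρ.isCompl_grading.disjoint _ (hpow n 0 _ h0) ?_
        rw [eq_neg_of_add_eq_zero_left hn]
        exact neg_mem (hpow n 1 _ h1)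
      rw [h2, zero_add] at hn
      exact add_mem (Submodule.mem_sup_left ⟨⟨n, h2⟩, h0⟩) (Submodule.mem_sup_right ⟨⟨n, hn⟩, h1⟩)
  intro w
  have hvW : v ∈ W := ⟨n, hn⟩
  have hW' : W = ⊤ := hW.resolve_left fun h => hv0 (by rwa [h, Submodule.mem_bot] at hvW)
  exact (hW' ▸ Submodule.mem_top : w ∈ W)

end Rep

/-! ### One-dimensionality of the real root spaces -/

section RootSpace

variable {a : ℂ} {γ : Weight} {x : Aff}

theorem snd_eq_zero_of_mem_rootSpace (hx : x ∈ rootSpace a γ) (hγ : γ ≠ 0) : x.2 = 0 := by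
  obtain ⟨h, hh⟩ : ∃ h, γ h ≠ 0 := by
    by_contra! h0
    exact hγ (LinearMap.ext h0)
  have h1 := affBracket_cartan_snd a h x
  rw [hx h, Prod.smul_snd] at h1
  exact (smul_eq_zero.1 h1).resolve_left hh

theorem even_entry_of_mem_rootSpace (hx : x ∈ rootSpace a γ) {n : ℤ} {i : Fin 3} {k l : Fin 2}
    (h0 : ((x.1 n).1 i : Matrix (Fin 2) (Fin 2) ℂ) k l ≠ 0) (h : Cartan) :
    γ h = h.1 i * (![![0, 2], ![-2, 0]] k l) + h.2.2 * n := by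
  have h1 := affBracket_cartan_fst a h x n
  rw [hx h] at h1
  have h2 : γ h * ((x.1 n).1 i : Matrix (Fin 2) (Fin 2) ℂ) k l =
      ((bracket a (cartanG h) (x.1 n)).1 i : Matrix (Fin 2) (Fin 2) ℂ) k l +
        (h.2.2 * n) * ((x.1 n).1 i : Matrix (Fin 2) (Fin 2) ℂ) k l :=
    congrArg (fun u : G => (u.1 i : Matrix (Fin 2) (Fin 2) ℂ) k l) h1
  rw [bracket_cartanG_fst, ← add_mul] at h2
  exact mul_right_cancel₀ h0 h2

theorem odd_entry_of_mem_rootSpace (hx : x ∈ rootSpace a γ) {n : ℤ} {s : Fin 3 → Fin 2}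
    (h0 : (x.1 n).2 s ≠ 0) (h : Cartan) :
    γ h = ∑ i, h.1 i * sgn (s i) + h.2.2 * n := by
  have h1 := affBracket_cartan_fst a h x n
  rw [hx h] at h1
  have h2 := congrArg (fun u : G => u.2 s) h1
  simp only [Prod.smul_fst, Finsupp.smul_apply, Prod.snd_add, Pi.add_apply, Prod.smul_snd,
    Pi.smul_apply, bracket_cartanG_snd, smul_eq_mul, ← add_mul] at h2
  exact mul_right_cancel₀ h0 h2

theorem sgn_injective : Function.Injective sgn := by decide

theorem sgn_ne_zero (b : Fin 2) : (sgn b : ℂ) ≠ 0 := fun h => by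
  have := sgn_mul_self b; rw [h] at this; simp at this

/-- Each non-zero entry of x forces its own weight to equal the given one. The weight of an even
entry vanishes on the diagonal directions of the other two summands, whereas an odd root is ±1 on
all three. -/
theorem eq_smul_oddG_of_mem_rootSpace {s : Fin 3 → Fin 2} {n : ℤ}
    (hx : x ∈ rootSpace a (wt (oddRoot s + imRoot n))) : ∃ c : ℂ, x = c • loop n (oddG s) := by
  have h2 := snd_eq_zero_of_mem_rootSpace hx fun h =>
    (isRoot_oddRoot s n).1 (wt_injective (by rw [h]; simp [wt]))
  have hγ : ∀ h, wt (oddRoot s + imRoot n) h = ∑ i, h.1 i * sgn (s i) + h.2.2 * n := fun h => by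
    rw [wt_add, LinearMap.add_apply, wt_oddRoot, wt_imRoot]
  refine ⟨(x.1 n).2 s, ?_⟩
  have he : ∀ m, (x.1 m).1 = 0 := fun m => by
    funext i
    ext k l
    by_contra h0
    have h3 := even_entry_of_mem_rootSpace hx h0 (cartanH (i + 1))
    rw [hγ] at h3
    have h4 : i ≠ i + 1 := by fin_cases i <;> simp
    simp [cartanH, Pi.single_apply, h4] at h3
    exact sgn_ne_zero _ (by simpa using h3)
  have ho : ∀ m t, (x.1 m).2 t ≠ 0 → m = n ∧ t = s := fun m t h0 => by
    have h3 := odd_entry_of_mem_rootSpace hx h0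
    simp only [hγ] at h3
    constructor
    · have := h3 cartanD
      simpa [cartanD, eq_comm] using this
    · funext i
      have := h3 (cartanH i)
      simp [cartanH, Pi.single_apply] at this
      exact (sgn_injective (by exact_mod_cast this)).symm
  refine Prod.ext ?_ (by rw [h2, Prod.smul_snd]; exact (smul_zero _).symm)
  ext1 m
  rw [Prod.smul_fst, Finsupp.smul_apply, loop, Finsupp.single_apply]
  refine Prod.ext ?_ ?_
  · rw [he]; split_ifs <;> simp [oddG]
  · funext t
    by_cases h0 : (x.1 m).2 t = 0
    · split_ifs with hm
      · subst hm
        by_cases ht : t = s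
        · subst ht; simp [h0]
        · simp [oddG, ht, h0]
      · simp [h0]
    · obtain ⟨rfl, rfl⟩ := ho m t h0
      simp [oddG]

/-- N is the matrix unit at (b, b') with eigenvalue z, so e and f are treated together; `hz` says
that no other entry has this eigenvalue. -/
theorem eq_smul_evenG_of_mem_rootSpace {c : Fin 4 → ℤ} (hc : IsRoot c) {k : Fin 3} {n : ℤ}
    {b b' : Fin 2} {N : SL2}
    (hN : ∀ i j, (N : Matrix (Fin 2) (Fin 2) ℂ) i j = if i = b ∧ j = b' then 1 else 0)
    {z : ℂ} (hz0 : z ≠ 0) (hγ : ∀ h, wt c h = z * h.1 k + h.2.2 * n)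
    (hz : ∀ i j, ![![(0 : ℂ), 2], ![-2, 0]] i j = z → i = b ∧ j = b')
    (hx : x ∈ rootSpace a (wt c)) : ∃ c : ℂ, x = c • loop n (evenG k N) := by
  have h2 := snd_eq_zero_of_mem_rootSpace hx fun h =>
    hc.1 (wt_injective (by rw [h]; simp [wt]))
  refine ⟨((x.1 n).1 k : Matrix (Fin 2) (Fin 2) ℂ) b b', ?_⟩
  have ho : ∀ m, (x.1 m).2 = 0 := fun m => by
    funext t
    by_contra h0
    have h3 := odd_entry_of_mem_rootSpace hx h0 (cartanH (k + 1))
    rw [hγ] at h3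
    have h4 : k ≠ k + 1 := by fin_cases k <;> simp
    simp [cartanH, Pi.single_apply, h4] at h3
    exact sgn_ne_zero _ (by simpa using h3.symm)
  have he : ∀ m i j j', ((x.1 m).1 i : Matrix (Fin 2) (Fin 2) ℂ) j j' ≠ 0 →
      m = n ∧ i = k ∧ j = b ∧ j' = b' := fun m i j j' h0 => by
    have h3 := even_entry_of_mem_rootSpace hx h0
    simp only [hγ] at h3
    have h4 := h3 (cartanH k)
    have hik : i = k := by
      by_contra hik
      simp [cartanH, hik] at h4
      exact hz0 h4
    subst hik
    refine ⟨?_, rfl, hz j j' ?_⟩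
    · have := h3 cartanD
      simpa [cartanD, eq_comm] using this
    · simpa [cartanH] using h4.symm
  refine Prod.ext ?_ (by rw [h2, Prod.smul_snd]; exact (smul_zero _).symm)
  ext1 m
  rw [Prod.smul_fst, Finsupp.smul_apply, loop, Finsupp.single_apply]
  refine Prod.ext ?_ ?_
  · funext i
    ext j j'
    by_cases h0 : ((x.1 m).1 i : Matrix (Fin 2) (Fin 2) ℂ) j j' = 0
    · rw [h0]
      split_ifs with hm
      · subst hm
        by_cases hi : i = k
        · subst hi
          by_cases hj : j = b ∧ j' = b'
          · obtain ⟨rfl, rfl⟩ := hj; simp [h0]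
          · simp [evenG, hN, hj]
        · simp [evenG, hi]
      · simp
    · obtain ⟨rfl, rfl, rfl, rfl⟩ := he m i j j' h0
      simp [evenG, hN]
  · rw [ho]; split_ifs <;> simp [evenG]

theorem eq_smul_eSL2_of_mem_rootSpace {k : Fin 3} {n : ℤ}
    (hx : x ∈ rootSpace a (wt (evenRoot k + imRoot n))) :
    ∃ c : ℂ, x = c • loop n (evenG k eSL2) := by
  refine eq_smul_evenG_of_mem_rootSpace (b := 0) (b' := 1) (isRoot_evenRoot k n) ?_
    (two_ne_zero) (fun h => ?_) ?_ hx
  · intro i j; fin_cases i <;> fin_cases j <;> simp [eSL2]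
  · rw [wt_add, LinearMap.add_apply, wt_evenRoot, wt_imRoot]
  · intro i j; fin_cases i <;> fin_cases j <;> norm_num

theorem isRoot_neg_evenRoot (k : Fin 3) (n : ℤ) : IsRoot (-evenRoot k + imRoot n) := by
  convert (isRoot_evenRoot k (-n)).neg using 1
  funext i
  simp [imRoot]
  ring

theorem eq_smul_fSL2_of_mem_rootSpace {k : Fin 3} {n : ℤ}
    (hx : x ∈ rootSpace a (wt (-evenRoot k + imRoot n))) :
    ∃ c : ℂ, x = c • loop n (evenG k fSL2) := by
  refine eq_smul_evenG_of_mem_rootSpace (b := 1) (b' := 0) (z := -2) (isRoot_neg_evenRoot k n) ?_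
    (by norm_num) (fun h => ?_) ?_ hx
  · intro i j; fin_cases i <;> fin_cases j <;> simp [fSL2]
  · rw [wt_add, LinearMap.add_apply, wt_neg, LinearMap.neg_apply, wt_evenRoot, wt_imRoot]; ring
  · intro i j; fin_cases i <;> fin_cases j <;> norm_num

/-- Among the simple roots only α_0 is non-zero on d, so d has eigenvalue `c 0` on x; this fixes the
power of t. -/
theorem exists_eq_loop_of_mem_rootSpace {c : Fin 4 → ℤ} (hc : IsRoot c)
    (hx : x ∈ rootSpace a (wt c)) : ∃ n u, x = loop n u := by
  have h2 := snd_eq_zero_of_mem_rootSpace hx fun h =>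
    hc.1 (wt_injective (by rw [h]; simp [wt]))
  refine ⟨c 0, x.1 (c 0), Prod.ext ?_ h2⟩
  have hγ : wt c cartanD = c 0 := by rw [wt_apply]; simp [cartanD]
  ext1 m
  rw [loop, Finsupp.single_apply]
  split_ifs with hm
  · rw [hm]
  · refine Prod.ext ?_ ?_
    · funext i
      ext j j'
      by_contra h0
      have := even_entry_of_mem_rootSpace hx h0 cartanD
      rw [hγ] at this
      simp [cartanD] at this
      exact hm this
    · funext t
      by_contra h0
      have := odd_entry_of_mem_rootSpace hx h0 cartanD
      rw [hγ] at this
      simp [cartanD] at this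
      exact hm this

/-- A central term is allowed in the argument so that the lemma can be iterated: a bracket of loop
elements may produce one. -/
theorem affBracket_evenG_mem_parity (a : ℂ) {j : ZMod 2} {k : Fin 3} {N : SL2} {m n : ℤ} {u : G}
    {c : ℂ} (h : ((Finsupp.single n u, c, 0) : Aff) ∈ parity j) :
    affBracket a (loop m (evenG k N)) (Finsupp.single n u, c, 0) ∈ parity j := by
  rw [affBracket_loop_loop_add_central, affBracket_loop, bracket_evenG, form_evenG]
  have hj : j = 0 ∨ j = 1 := (by decide : ∀ j : ZMod 2, j = 0 ∨ j = 1) j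
  rcases hj with rfl | rfl
  · intro r
    have hu : u.2 = 0 := by simpa using h n
    by_cases hr : m + n = r <;> simp [hr, hu]
  · rw [parity, if_neg (by decide)] at h ⊢
    have hu : u.1 = 0 := by simpa using h.1 n
    refine ⟨fun r => ?_, ?_⟩
    · by_cases hr : m + n = r <;> simp [hr, hu]
    · simp [hu]

end RootSpace

namespace Rep

variable {a : ℂ} {V : Type*} [AddCommGroup V] [Module ℂ V] {ρ : Rep a V}

theorem comm_comm_comm_act {k : Fin 3} {N : SL2} (hN : (N : Matrix (Fin 2) (Fin 2) ℂ) * N = 0)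
    {c : Fin 4 → ℤ} {m : ℤ} (hf : loop m (evenG k N) ∈ rootSpace a (wt c)) {x : Aff}
    (hx : x ∈ generators a) :
    comm (ρ.act (loop m (evenG k N))) (comm (ρ.act (loop m (evenG k N)))
      (comm (ρ.act (loop m (evenG k N))) (ρ.act x))) = 0 := by
  have hp := loop_evenG_mem_parity m k N
  rcases hx with ⟨h, rfl⟩ | ⟨d, hd, hx, j, hj⟩
  · have h1 := ρ.act_bracket_even (cartan_mem_parity h) hp
    rw [hf h, map_smul] at h1
    -- ad f sends a Cartan element to a multiple of f, which the next commutator kills.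
    have h2 : comm (ρ.act (loop m (evenG k N))) (ρ.act (cartan h)) =
        (-(wt c h)) • ρ.act (loop m (evenG k N)) := by
      rw [neg_smul, h1, comm, neg_sub]
    rw [h2, comm_smul]
    simp [comm]
  · obtain ⟨n, u, rfl⟩ := exists_eq_loop_of_mem_rootSpace hd hx
    have h1 := affBracket_evenG_mem_parity a (k := k) (N := N) (m := m) hj
    rw [show ((Finsupp.single n u, 0, 0) : Aff) = loop n u from rfl] at h1
    have h2 := h1
    rw [affBracket_loop] at h2
    have h3 := affBracket_evenG_mem_parity a (k := k) (N := N) (m := m) h2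
    rw [← affBracket_loop] at h3
    rw [← act_affBracket_eq_comm hp hj, ← act_affBracket_eq_comm hp h1,
      ← act_affBracket_eq_comm hp h3]
    exact (congrArg ρ.act (affBracket_evenG_thrice hN a k m n u)).trans (map_zero _)

end Rep

/-! ### Combinatorics of the roots -/

/-- The height function of the simple roots `α_0, …, α_3`. -/
def height : Fin 4 → ℤ := fun _ => 1

/-- The height function of the positive system obtained by the odd reflection in `α_i`, whose
simple roots are `-α_i` and the `α_i + α_l` with `l ≠ i`. -/
def reflHeight (i : Fin 4) : Fin 4 → ℤ := Function.update (fun _ => 2) i (-1)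

/-- The coordinate at `-α_i` with respect to the reflected simple roots. -/
def reflCoord (i : Fin 4) : Fin 4 → ℤ := Function.update (fun _ => 1) i (-1)

theorem dot_single (c : Fin 4 → ℤ) (l : Fin 4) : dot c (Pi.single l 1) = c l := by
  simp [dot, Pi.single_apply]

namespace IsRoot

variable {c : Fin 4 → ℤ}

theorem exists_ne_zero (hc : IsRoot c) : ∃ k, c k ≠ 0 := Function.ne_iff.1 hc.1

/-- Entries that differ by at most one cannot have opposite signs, so their sum vanishes only if all
of them do. -/
theorem dot_height_ne_zero (hc : IsRoot c) : dot c height ≠ 0 := by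
  obtain ⟨k, hk⟩ := hc.exists_ne_zero
  have h0 := hc.2 k
  have h1 := fun l => hc.2 l k
  simp only [Fin.forall_fin_succ] at h0 h1
  simp only [dot, height, Fin.sum_univ_four]
  fin_cases k <;> simp at * <;> omega

theorem apply_nonpos (hc : IsRoot c) (h : dot c height < 0) (l : Fin 4) : c l ≤ 0 := by
  have h0 := hc.2 l
  simp only [dot, height, Fin.sum_univ_four] at h
  have := h0 0; have := h0 1; have := h0 2; have := h0 3
  omega

theorem apply_nonneg (hc : IsRoot c) (h : 0 < dot c height) (l : Fin 4) : 0 ≤ c l := by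
  have h0 := fun k => hc.2 k l
  simp only [dot, height, Fin.sum_univ_four] at h
  have := h0 0; have := h0 1; have := h0 2; have := h0 3
  omega

/-- In the reflected base a root has coordinate c_l at α_i + α_l and `dot c (reflCoord i)` at -α_i.
These never have opposite signs, and `reflHeight i` gives their sum. -/
theorem dot_reflHeight_ne_zero (hc : IsRoot c) (i : Fin 4) : dot c (reflHeight i) ≠ 0 := by
  obtain ⟨k, hk⟩ := hc.exists_ne_zero
  have h := hc.2
  have := h 0 1; have := h 0 2; have := h 0 3; have := h 1 2; have := h 1 3; have := h 2 3
  have := h 1 0; have := h 2 0; have := h 3 0; have := h 2 1; have := h 3 1; have := h 3 2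
  simp only [dot, reflHeight, Fin.sum_univ_four]
  fin_cases i <;> fin_cases k <;> simp at * <;> omega

theorem apply_nonpos_of_reflHeight (hc : IsRoot c) {i l : Fin 4} (h : dot c (reflHeight i) < 0)
    (hl : l ≠ i) : c l ≤ 0 := by
  have h' := hc.2
  have := h' 0 1; have := h' 0 2; have := h' 0 3; have := h' 1 2; have := h' 1 3
  have := h' 2 3; have := h' 1 0; have := h' 2 0; have := h' 3 0; have := h' 2 1
  have := h' 3 1; have := h' 3 2
  simp only [dot, reflHeight, Fin.sum_univ_four] at h
  fin_cases i <;> fin_cases l <;> simp at * <;> omega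

theorem reflCoord_nonpos (hc : IsRoot c) {i : Fin 4} (h : dot c (reflHeight i) < 0) :
    dot c (reflCoord i) ≤ 0 := by
  have h' := hc.2
  have := h' 0 1; have := h' 0 2; have := h' 0 3; have := h' 1 2; have := h' 1 3
  have := h' 2 3; have := h' 1 0; have := h' 2 0; have := h' 3 0; have := h' 2 1
  have := h' 3 1; have := h' 3 2
  simp only [dot, reflHeight, reflCoord, Fin.sum_univ_four] at *
  fin_cases i <;> simp at * <;> omega

/-- The only positive multiple of α_i that is a root is α_i itself. -/
theorem exists_pos (hc : IsRoot c) {i : Fin 4} (h : 0 < dot c height) (hci : c ≠ Pi.single i 1) :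
    ∃ l, l ≠ i ∧ 0 < c l := by
  by_contra! hl
  apply hci
  have h' := hc.2
  have := h' 0 1; have := h' 0 2; have := h' 0 3; have := h' 1 2; have := h' 1 3
  have := h' 2 3; have := h' 1 0; have := h' 2 0; have := h' 3 0; have := h' 2 1
  have := h' 3 1; have := h' 3 2
  have := hl 0; have := hl 1; have := hl 2; have := hl 3
  simp only [dot, height, Fin.sum_univ_four] at h
  funext k
  fin_cases i <;> fin_cases k <;> simp at * <;> omega

/-- The two positive systems differ only in ±α_i. -/
theorem height_pos_of_reflHeight (hc : IsRoot c) {i : Fin 4} (h : 0 < dot c (reflHeight i))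
    (hci : c ≠ -Pi.single i 1) : 0 < dot c height := by
  by_contra h0
  apply hci
  have h' := hc.2
  have := h' 0 1; have := h' 0 2; have := h' 0 3; have := h' 1 2; have := h' 1 3
  have := h' 2 3; have := h' 1 0; have := h' 2 0; have := h' 3 0; have := h' 2 1
  have := h' 3 1; have := h' 3 2
  simp only [dot, height, reflHeight, Fin.sum_univ_four] at *
  funext k
  fin_cases i <;> fin_cases k <;> simp at * <;> omega

theorem ne_single_of_reflHeight {i : Fin 4} (h : 0 < dot c (reflHeight i)) :
    c ≠ Pi.single i 1 := by
  rintro rfl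
  simp only [dot, reflHeight, Fin.sum_univ_four] at h
  fin_cases i <;> simp at h

/-- The analogue of `exists_pos` for the reflected base, where α_i + α_j is simple: any other
positive root involves a further simple root. -/
theorem exists_pos_of_reflHeight (hc : IsRoot c) {i j : Fin 4} (hij : i ≠ j)
    (h : 0 < dot c (reflHeight i)) (hci : c ≠ Pi.single i 1 + Pi.single j 1) :
    (∃ l, l ≠ i ∧ l ≠ j ∧ 0 < c l) ∨ 0 < dot c (reflCoord i) := by
  by_contra! hl
  obtain ⟨hl, hr⟩ := hl
  apply hci
  have h' := hc.2
  have := h' 0 1; have := h' 0 2; have := h' 0 3; have := h' 1 2; have := h' 1 3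
  have := h' 2 3; have := h' 1 0; have := h' 2 0; have := h' 3 0; have := h' 2 1
  have := h' 3 1; have := h' 3 2
  have := hl 0; have := hl 1; have := hl 2; have := hl 3
  simp only [dot, reflHeight, reflCoord, Fin.sum_univ_four] at *
  funext k
  fin_cases i <;> fin_cases j <;> (try exact absurd rfl hij) <;> fin_cases k <;>
    simp at * <;> omega

end IsRoot

/-! ### Odd reflections and integrability at a sum of two simple roots -/

namespace Rep

variable {a : ℂ} {V : Type*} [AddCommGroup V] [Module ℂ V] {ρ : Rep a V}

theorem IsSingular.of_isHighestWeightVector {μ : Weight} {v : V}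
    (hv : ρ.IsHighestWeightVector μ v) : ρ.IsSingular height μ v := by
  refine ⟨⟨0, hv.2.1⟩, hv.2.2.2, fun c hc hp x hx => ?_⟩
  by_cases hx0 : x = 0
  · rw [hx0, map_zero, LinearMap.zero_apply]
  refine hv.2.2.1 (wt c) ⟨fun h => ?_, ⟨x, hx.1, hx0⟩, fun i => (c i).toNat, ?_⟩ x hx.1
  · exact hc.1 (wt_injective (by rw [h]; simp [wt]))
  · refine Finset.sum_congr rfl fun i _ => ?_
    rw [← natCast_zsmul, Int.toNat_of_nonneg (hc.apply_nonneg hp i)]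

/-- Root vectors for an isotropic simple root `α_i` and its negative, with their bracket. -/
structure IsOddPair (a : ℂ) (i : Fin 4) (e f : Aff) (h : Cartan) : Prop where
  e_mem : e ∈ rootSpace a (wt (Pi.single i 1))
  f_mem : f ∈ rootSpace a (wt (-Pi.single i 1))
  e_parity : e ∈ parity 1
  f_parity : f ∈ parity 1
  e_span : ∀ x ∈ rootSpace a (wt (Pi.single i 1)), ∃ c : ℂ, x = c • e
  f_span : ∀ x ∈ rootSpace a (wt (-Pi.single i 1)), ∃ c : ℂ, x = c • f
  bracket_e_f : affBracket a e f = cartan h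
  bracket_f_f : affBracket a f f = 0

/-- Root vectors for an even real root with coordinates `β` and its negative, with their bracket,
the coroot. -/
structure IsEvenPair (a : ℂ) (β : Fin 4 → ℤ) (e f : Aff) (h : Cartan) : Prop where
  e_mem : e ∈ rootSpace a (wt β)
  f_mem : f ∈ rootSpace a (wt (-β))
  e_parity : e ∈ parity 0
  f_parity : f ∈ parity 0
  e_span : ∀ x ∈ rootSpace a (wt β), ∃ c : ℂ, x = c • e
  f_span : ∀ x ∈ rootSpace a (wt (-β)), ∃ c : ℂ, x = c • f
  bracket_e_f : affBracket a e f = cartan h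
  wt_coroot : wt β h = 2
  exists_eq_loop : ∃ (n : ℤ) (k : Fin 3) (N : SL2),
    (N : Matrix (Fin 2) (Fin 2) ℂ) * N = 0 ∧ f = loop n (evenG k N)

theorem IsEvenPair.comm_comm_comm {β : Fin 4 → ℤ} {e f : Aff} {h : Cartan}
    (hp : IsEvenPair a β e f h) {x : Aff} (hx : x ∈ generators a) :
    comm (ρ.act f) (comm (ρ.act f) (comm (ρ.act f) (ρ.act x))) = 0 := by
  obtain ⟨n, k, N, hN, rfl⟩ := hp.exists_eq_loop
  exact comm_comm_comm_act hN hp.f_mem hx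

theorem dot_single_left (i : Fin 4) (q : Fin 4 → ℤ) : dot (Pi.single i 1) q = q i := by
  simp [dot, Pi.single_apply]

theorem dot_nsmul_neg (n : ℕ) (c q : Fin 4 → ℤ) : dot (n • -c) q = -(n * dot c q) := by
  simp only [dot, Pi.smul_apply, Pi.neg_apply, smul_mul_assoc, neg_mul, ← Finset.smul_sum,
    Finset.sum_neg_distrib]
  simp

/-- The vector has weight Λ - α_i + c, and c has a positive coordinate at some l ≠ i, so this weight
is not below Λ. -/
theorem IsSingular.act_odd_eq_zero (hρ : ρ.IsIrreducible) {Λ : Weight} {v : V}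
    (hv : ρ.IsSingular height Λ v) (hv0 : v ≠ 0) {i : Fin 4} {e f : Aff} {h : Cartan}
    (hp : IsOddPair a i e f h) {c : Fin 4 → ℤ} (hc : IsRoot c) (hpos : 0 < dot c height)
    (hci : c ≠ Pi.single i 1) {x : Aff} (hx : x ∈ rootVectors a c) :
    ρ.act x (ρ.act f v) = 0 := by
  obtain ⟨l, hl, hcl⟩ := hc.exists_pos hpos hci
  obtain ⟨hx, j, hj⟩ := hx
  have h1 := (hv.hasWeight.act hp.f_mem hp.f_parity).act hx hj
  rw [add_assoc, ← wt_add] at h1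
  refine hv.eq_zero_of_pos hρ (q := Pi.single l 1) (fun _ h => h.dot_height_ne_zero)
    (fun c hc h => ?_) hv0 h1 ?_
  · rw [dot_single]; exact hc.apply_nonpos h l
  · rw [dot_single]; simpa [hl] using hcl

theorem IsSingular.e_f_apply {Λ : Weight} {v : V} (hv : ρ.IsSingular height Λ v) {i : Fin 4}
    {e f : Aff} {h : Cartan} (hp : IsOddPair a i e f h) :
    ρ.act e (ρ.act f v) = Λ h • v := by
  have h1 := LinearMap.congr_fun (ρ.act_bracket_odd hp.e_parity hp.f_parity) v
  have h2 : IsRoot (Pi.single i 1) := by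
    refine ⟨fun h => by simpa using congrFun h i, fun k l => ?_⟩
    simp only [Pi.single_apply]
    split_ifs <;> simp
  have h3 : ρ.act e v = 0 := hv.act_eq_zero _ h2 (by simp [dot, height]) e ⟨hp.e_mem, 1, hp.e_parity⟩
  rw [hp.bracket_e_f, LinearMap.add_apply, Module.End.mul_apply, Module.End.mul_apply, h3, map_zero,
    add_zero, hv.hasWeight] at h1
  exact h1.symm

/-- If `Λ` vanishes on the coroot of an isotropic simple root, then the negative root vector kills
the highest weight vector. -/
theorem IsSingular.f_apply_eq_zero (hρ : ρ.IsIrreducible) {Λ : Weight} {v : V}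
    (hv : ρ.IsSingular height Λ v) (hv0 : v ≠ 0) {i : Fin 4} {e f : Aff} {h : Cartan}
    (hp : IsOddPair a i e f h) (hΛ : Λ h = 0) : ρ.act f v = 0 := by
  have hu : ρ.IsSingular height (Λ + wt (-Pi.single i 1)) (ρ.act f v) := by
    obtain ⟨j, hj⟩ := hv.homogeneous
    refine ⟨⟨1 + j, ρ.act_mem 1 j f hp.f_parity v hj⟩, hv.hasWeight.act hp.f_mem hp.f_parity,
      fun c hc hpos x hx => ?_⟩
    by_cases hci : c = Pi.single i 1
    · subst hci
      obtain ⟨k, rfl⟩ := hp.e_span x hx.1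
      rw [map_smul, LinearMap.smul_apply, hv.e_f_apply hp, hΛ, zero_smul, smul_zero]
    · exact hv.act_odd_eq_zero hρ hv0 hp hc hpos hci hx
  refine hu.eq_zero hρ (fun _ h => h.dot_height_ne_zero) hv.hasWeight hv0 rfl ?_
  simp [dot, height]

/-- The highest weight vector with respect to the positive system reflected in `α_i`. -/
theorem IsSingular.exists_reflected (hρ : ρ.IsIrreducible) {Λ : Weight} {v : V}
    (hv : ρ.IsSingular height Λ v) (hv0 : v ≠ 0) {i : Fin 4} {e f : Aff} {h : Cartan}
    (hp : IsOddPair a i e f h) :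
    ∃ (v' : V) (Λ' : Weight), v' ≠ 0 ∧ ρ.IsSingular (reflHeight i) Λ' v' ∧
      ((Λ h ≠ 0 ∧ Λ' = Λ + wt (-Pi.single i 1)) ∨ (Λ h = 0 ∧ Λ' = Λ)) := by
  by_cases hΛ : Λ h = 0
  · refine ⟨v, Λ, hv0, ⟨hv.homogeneous, hv.hasWeight, fun c hc hpos x hx => ?_⟩, Or.inr ⟨hΛ, rfl⟩⟩
    by_cases hci : c = -Pi.single i 1
    · subst hci
      obtain ⟨k, rfl⟩ := hp.f_span x hx.1
      rw [map_smul, LinearMap.smul_apply, hv.f_apply_eq_zero hρ hv0 hp hΛ, smul_zero]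
    · exact hv.act_eq_zero c hc (hc.height_pos_of_reflHeight hpos hci) x hx
  · refine ⟨ρ.act f v, _, fun h0 => ?_, ⟨?_, hv.hasWeight.act hp.f_mem hp.f_parity,
      fun c hc hpos x hx => ?_⟩, Or.inl ⟨hΛ, rfl⟩⟩
    · have := hv.e_f_apply hp
      rw [h0, map_zero] at this
      exact smul_ne_zero hΛ hv0 this.symm
    · obtain ⟨j, hj⟩ := hv.homogeneous
      exact ⟨1 + j, ρ.act_mem 1 j f hp.f_parity v hj⟩
    · by_cases hci : c = -Pi.single i 1
      · subst hci
        obtain ⟨k, rfl⟩ := hp.f_span x hx.1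
        -- For odd f the relation [f, f] = 0 reads 2f² = 0.
        have h1 := LinearMap.congr_fun (ρ.act_bracket_odd hp.f_parity hp.f_parity) v
        rw [hp.bracket_f_f, map_zero, LinearMap.zero_apply, LinearMap.add_apply,
          Module.End.mul_apply, ← two_smul ℂ] at h1
        rw [map_smul, LinearMap.smul_apply, (smul_eq_zero.1 h1.symm).resolve_left two_ne_zero,
          smul_zero]
      · exact hv.act_odd_eq_zero hρ hv0 hp hc (hc.height_pos_of_reflHeight hpos hci)
          (IsRoot.ne_single_of_reflHeight hpos) hx

theorem HasWeight.pow_act {μ : Weight} {v : V} (hv : ρ.HasWeight μ v) {β : Fin 4 → ℤ} {f : Aff}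
    (hf : f ∈ rootSpace a (wt β)) (hf0 : f ∈ parity 0) (n : ℕ) :
    ρ.HasWeight (μ + wt (n • β)) ((ρ.act f ^ n) v) := by
  induction n with
  | zero => simpa [wt] using hv
  | succ n ih =>
    rw [pow_succ', Module.End.mul_apply, add_smul, one_smul, wt_add, ← add_assoc]
    exact ih.act hf hf0

/-- For a singular vector with respect to a positive system in which `α_i + α_j` is simple, local
nilpotency of the negative root vector is decided by the value of the weight on the coroot. -/
theorem IsSingular.locNilp_iff (hρ : ρ.IsIrreducible) {Λ : Weight} {v : V} {i j : Fin 4}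
    (hij : i ≠ j) (hv : ρ.IsSingular (reflHeight i) Λ v) (hv0 : v ≠ 0) {e f : Aff} {h : Cartan}
    (hp : IsEvenPair a (Pi.single i 1 + Pi.single j 1) e f h) :
    LocNilp (ρ.act f) ↔ IsNat (Λ h) := by
  set β : Fin 4 → ℤ := Pi.single i 1 + Pi.single j 1 with hβ
  have hβroot : IsRoot β := by
    refine ⟨fun h => ?_, fun k l => ?_⟩
    · have := congrFun h i
      simp [hβ, hij] at this
    · simp only [hβ, Pi.add_apply, Pi.single_apply]
      split_ifs with h1 h2 <;> simp_all
  have hβpos : 0 < dot β (reflHeight i) := by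
    simp [hβ, dot_add, dot_single_left, reflHeight, hij.symm]
  have he : ρ.act e v = 0 := hv.act_eq_zero β hβroot hβpos e ⟨hp.e_mem, 0, hp.e_parity⟩
  have hef : ρ.act e * ρ.act f - ρ.act f * ρ.act e = ρ.act (cartan h) := by
    rw [← ρ.act_bracket_even hp.e_parity hp.f_parity, hp.bracket_e_f]
  have hhf : ρ.act (cartan h) * ρ.act f - ρ.act f * ρ.act (cartan h) = (-2 : ℂ) • ρ.act f := by
    rw [← ρ.act_bracket_even (cartan_mem_parity h) hp.f_parity, hp.f_mem h, map_smul, wt_neg,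
      LinearMap.neg_apply, hp.wt_coroot]
  constructor
  · intro hf
    obtain ⟨n, hn⟩ := hf v
    exact isNat_of_pow_apply_eq_zero hef hhf hv0 he (hv.hasWeight h) hn
  · rintro ⟨n, hn⟩
    refine locNilp_of_pow_apply_eq_zero hρ hp.f_parity (fun x hx => hp.comm_comm_comm hx) hv0 (n := n + 1) ?_
    have hw := hv.hasWeight.pow_act hp.f_mem hp.f_parity (n + 1)
    -- e kills f^(n+1) v because Λ(h) = n. Any other positive root vector raises a reflected
    -- coordinate at which β is zero, so it leads above Λ. Thus f^(n+1) v is singular of smaller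
    -- weight, hence zero.
    have hu : ρ.IsSingular (reflHeight i) (Λ + wt ((n + 1) • -β)) ((ρ.act f ^ (n + 1)) v) := by
      refine ⟨?_, hw, fun c hc hpos x hx => ?_⟩
      · obtain ⟨k, hk⟩ := hv.homogeneous
        refine ⟨k, ?_⟩
        induction n + 1 with
        | zero => exact hk
        | succ n ih =>
          rw [pow_succ', Module.End.mul_apply]
          simpa using ρ.act_mem 0 k f hp.f_parity _ ih
      · by_cases hcβ : c = β
        · subst hcβ
          obtain ⟨k, rfl⟩ := hp.e_span x hx.1
          rw [map_smul, LinearMap.smul_apply, (sl2_pow hef hhf he (hv.hasWeight h) n).2, hn]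
          simp
        · obtain ⟨hx, k, hk⟩ := hx
          have h1 := hw.act hx hk
          rw [add_assoc, ← wt_add] at h1
          rcases hc.exists_pos_of_reflHeight hij hpos hcβ with ⟨l, hli, hlj, hl⟩ | hl
          · refine hv.eq_zero_of_pos hρ (q := Pi.single l 1)
              (fun _ h => h.dot_reflHeight_ne_zero i) (fun c hc h => ?_) hv0 h1 ?_
            · rw [dot_single]; exact hc.apply_nonpos_of_reflHeight h hli
            · rw [dot_single]; simpa [hβ, hli, hlj] using hl
          · refine hv.eq_zero_of_pos hρ (q := reflCoord i)
              (fun _ h => h.dot_reflHeight_ne_zero i) (fun c hc h => hc.reflCoord_nonpos h) hv0 h1 ?_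
            have h3 : dot β (reflCoord i) = 0 := by
              simp [hβ, dot_add, dot_single_left, reflCoord, hij.symm]
            rw [dot_add, dot_nsmul_neg, h3, mul_zero, neg_zero, zero_add]
            exact hl
    refine hu.eq_zero hρ (fun _ h => h.dot_reflHeight_ne_zero i) hv.hasWeight hv0 rfl ?_
    rw [dot_nsmul_neg]
    have : 0 < ((n + 1 : ℕ) : ℤ) * dot β (reflHeight i) := by positivity
    omega

/-- Integrability for the sum of two isotropic simple roots. -/
theorem IsL.isIntegrableAt_iff {Λ : Weight} (hL : ρ.IsL Λ) {i j : Fin 4} (hij : i ≠ j)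
    {e₁ f₁ : Aff} {h₁ : Cartan} (hp₁ : IsOddPair a i e₁ f₁ h₁) {e f : Aff} {h : Cartan}
    (hp : IsEvenPair a (Pi.single i 1 + Pi.single j 1) e f h) (hih : simpleRoot i h = 1) :
    ρ.IsIntegrableAt (simpleRoot i + simpleRoot j) ↔
      IsNat (Λ h) ∧ (Λ h = 0 → Λ h₁ = 0) := by
  obtain ⟨hρ, v, hv⟩ := hL
  have h1 : ρ.IsIntegrableAt (simpleRoot i + simpleRoot j) ↔ LocNilp (ρ.act f) := by
    rw [IsIntegrableAt, ← wt_single i, ← wt_single j, ← wt_add, ← wt_neg]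
    refine ⟨fun H => H f hp.f_mem, fun H x hx => ?_⟩
    obtain ⟨c, rfl⟩ := hp.f_span x hx
    rw [map_smul]
    exact H.smul c
  obtain ⟨v', Λ', hv0', hv', hΛ'⟩ :=
    (IsSingular.of_isHighestWeightVector hv).exists_reflected hρ hv.1 hp₁
  rw [h1, hv'.locNilp_iff hρ hij hv0' hp]
  rcases hΛ' with ⟨h0, rfl⟩ | ⟨h0, rfl⟩
  -- The reflected weight is Λ - α_i and α_i(h) = 1, so the condition becomes Λ(h) - 1 ∈ ℕ; this is
  -- how the value 0 gets excluded.
  · rw [LinearMap.add_apply, wt_neg, LinearMap.neg_apply, wt_single, hih]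
    constructor
    · rintro ⟨n, hn⟩
      have h2 : Λ h = (n + 1 : ℕ) := by push_cast; linear_combination hn
      refine ⟨⟨n + 1, h2⟩, fun h3 => ?_⟩
      rw [h2] at h3
      exact absurd h3 (by exact_mod_cast Nat.succ_ne_zero n)
    · rintro ⟨⟨n, hn⟩, h2⟩
      rcases n with _ | n
      · exact absurd (h2 (by simpa using hn)) h0
      · exact ⟨n, by rw [hn]; push_cast; ring⟩
  · exact ⟨fun h2 => ⟨h2, fun _ => h0⟩, fun h2 => h2.1⟩

end Rep

/-! ### Coroots and explicit root vectors -/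

theorem oddRoot_flip (s : Fin 3 → Fin 2) : oddRoot (flip s) = -oddRoot s := by
  have h : ∀ b : Fin 2, ((b + 1 : Fin 2).val : ℤ) = 1 - b.val := by decide
  funext i
  fin_cases i <;> simp [oddRoot, flip, h] <;> ring

theorem imRoot_neg (n : ℤ) : imRoot (-n) = -imRoot n := rfl

@[simp] theorem imRoot_zero : imRoot 0 = 0 := rfl

theorem toCartan_add (a : ℂ) (γ γ' : Weight) :
    toCartan a (γ + γ') = toCartan a γ + toCartan a γ' := by
  simp only [toCartan, LinearMap.add_apply, mul_add]
  rfl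

theorem toCartan_wt_oddRoot (a : ℂ) (s : Fin 3 → Fin 2) (n : ℤ) :
    toCartan a (wt (oddRoot s + imRoot n)) = (fun i => sigma a i / 2 * sgn (s i), (n : ℂ), 0) := by
  simp only [toCartan, wt_add, LinearMap.add_apply, wt_oddRoot, wt_imRoot]
  simp [cartanH, cartanD, cartanK, Pi.single_apply]

/-- The factor σ_k between a root and its coroot is the denominator in the integrality conditions.
-/
theorem toCartan_wt_evenRoot (a : ℂ) (k : Fin 3) :
    toCartan a (wt (evenRoot k)) = sigma a k • cartanH k := by
  simp only [toCartan, wt_evenRoot]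
  refine Prod.ext ?_ (by simp [cartanH, cartanD, cartanK])
  funext i
  by_cases h : i = k
  · subst h; simp [cartanH]
  · have h' : k ≠ i := Ne.symm h
    simp [cartanH, h, h']

theorem toCartan_wt_neg_evenRoot (a : ℂ) {k : Fin 3} (hk : sigma a k ≠ 0) :
    toCartan a (wt (-evenRoot k + imRoot 1)) =
      sigma a k • (-cartanH k + (sigma a k)⁻¹ • cartanK) := by
  simp only [toCartan, wt_add, wt_neg, LinearMap.add_apply, LinearMap.neg_apply, wt_evenRoot,
    wt_imRoot]
  refine Prod.ext ?_ (by simp [cartanH, cartanD, cartanK, hk])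
  funext i
  by_cases h : i = k
  · subst h; simp [cartanH, cartanK]
  · have h' : k ≠ i := Ne.symm h
    simp [cartanH, cartanK, h, h']

namespace Rep

variable {a : ℂ} {V : Type*} [AddCommGroup V] [Module ℂ V] {ρ : Rep a V}

/-- The bracket h is a non-zero multiple of the image of α_i; only whether Λ vanishes on it is
needed. -/
theorem exists_isOddPair (a : ℂ) (i : Fin 4) : ∃ (e f : Aff) (h : Cartan), IsOddPair a i e f h ∧
    ∀ Λ : Weight, Λ h = 0 ↔ Λ (toCartan a (simpleRoot i)) = 0 := by
  obtain ⟨s, n, hs⟩ : ∃ s n, Pi.single i 1 = oddRoot s + imRoot n := by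
    -- The entry 1 in s stands for a minus sign; δ occurs only in α_0 = δ - ε_0 - ε_1 - ε_2.
    fin_cases i
    · exact ⟨![1, 1, 1], 1, by funext k; fin_cases k <;> simp [oddRoot, imRoot]⟩
    · exact ⟨![1, 0, 0], 0, by funext k; fin_cases k <;> simp [oddRoot]⟩
    · exact ⟨![0, 1, 0], 0, by funext k; fin_cases k <;> simp [oddRoot]⟩
    · exact ⟨![0, 0, 1], 0, by funext k; fin_cases k <;> simp [oddRoot]⟩
  have hs' : -Pi.single i 1 = oddRoot (flip s) + imRoot (-n) := by
    rw [hs, oddRoot_flip, imRoot_neg, neg_add]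
  refine ⟨loop n (oddG s), loop (-n) (oddG (flip s)), _,
    ⟨hs ▸ loop_oddG_mem a n s, hs' ▸ loop_oddG_mem a (-n) (flip s), loop_oddG_mem_parity _ _,
      loop_oddG_mem_parity _ _, fun x hx => eq_smul_oddG_of_mem_rootSpace (hs ▸ hx),
      fun x hx => eq_smul_oddG_of_mem_rootSpace (hs' ▸ hx), affBracket_oddG_flip a n s,
      affBracket_oddG_self _ _ _⟩, fun Λ => ?_⟩
  rw [← wt_single, hs, toCartan_wt_oddRoot, map_smul, smul_eq_mul, mul_eq_zero]
  refine or_iff_right (mul_ne_zero (by norm_num) (Finset.prod_ne_zero_iff.2 fun j _ => ?_))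
  exact sgn_ne_zero _

theorem isEvenPair_evenRoot (a : ℂ) (k : Fin 3) :
    IsEvenPair a (evenRoot k) (loop 0 (evenG k eSL2)) (loop 0 (evenG k fSL2)) (cartanH k) where
  e_mem := by simpa using loop_eSL2_mem a 0 k
  f_mem := by simpa using loop_fSL2_mem a 0 k
  e_parity := loop_evenG_mem_parity _ _ _
  f_parity := loop_evenG_mem_parity _ _ _
  e_span x hx := eq_smul_eSL2_of_mem_rootSpace (by simpa using hx)
  f_span x hx := eq_smul_fSL2_of_mem_rootSpace (by simpa using hx)
  bracket_e_f := by
    rw [affBracket_loop, bracket_evenG_evenG, lie_eSL2_fSL2]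
    refine Prod.ext ?_ (by simp [cartan, cartanH])
    simp only [cartan, cartanH, evenG, add_zero]
    congr 2
    funext i
    by_cases h : i = k
    · subst h; simp
    · simp [h]
  wt_coroot := by rw [wt_evenRoot]; simp [cartanH]
  exists_eq_loop := ⟨0, k, fSL2, coe_fSL2_mul_self, rfl⟩

/-- The central part of the coroot is the cocycle term 1 · σ_k⁻¹ tr(fe) = σ_k⁻¹. -/
theorem isEvenPair_neg_evenRoot (a : ℂ) (k : Fin 3) :
    IsEvenPair a (-evenRoot k + imRoot 1) (loop 1 (evenG k fSL2)) (loop (-1) (evenG k eSL2))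
      (-cartanH k + (sigma a k)⁻¹ • cartanK) where
  e_mem := loop_fSL2_mem a 1 k
  f_mem := by
    rw [neg_add, neg_neg, ← imRoot_neg]
    exact loop_eSL2_mem a (-1) k
  e_parity := loop_evenG_mem_parity _ _ _
  f_parity := loop_evenG_mem_parity _ _ _
  e_span x hx := eq_smul_fSL2_of_mem_rootSpace hx
  f_span x hx := by
    rw [neg_add, neg_neg, ← imRoot_neg] at hx
    exact eq_smul_eSL2_of_mem_rootSpace hx
  bracket_e_f := by
    rw [affBracket_loop, bracket_evenG_evenG, form_evenG_evenG, ← lie_skew, lie_eSL2_fSL2]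
    refine Prod.ext ?_ ?_
    · simp only [cartan, cartanH, cartanK, evenG, add_neg_cancel]
      congr 2
      funext i
      by_cases h : i = k
      · subst h; simp
      · simp [h]
    · simp [cartan, cartanH, cartanK, fSL2, eSL2, Matrix.trace_fin_two]
  wt_coroot := by
    rw [wt_add, LinearMap.add_apply, wt_neg, LinearMap.neg_apply, wt_evenRoot, wt_imRoot]
    simp [cartanH, cartanK]
  exists_eq_loop := ⟨-1, k, eSL2, coe_eSL2_mul_self, rfl⟩

/-- Integrability for the sum of two isotropic simple roots, in terms of the labels of the highest
weight. -/
theorem IsL.isIntegrableAt_iff_label {Λ : Weight} (hL : ρ.IsL Λ) {m : Fin 4 → ℂ}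
    (hm : ∀ i, Λ (toCartan a (simpleRoot i)) = m i) {i j : Fin 4} (hij : i ≠ j) {z : ℂ}
    (hz : z ≠ 0) {e f : Aff} {h : Cartan}
    (hp : IsEvenPair a (Pi.single i 1 + Pi.single j 1) e f h) (hih : simpleRoot i h = 1)
    (hh : toCartan a (wt (Pi.single i 1 + Pi.single j 1)) = z • h) :
    ρ.IsIntegrableAt (simpleRoot i + simpleRoot j) ↔
      IsNat ((m i + m j) / z) ∧ (m i + m j = 0 → m i = 0 ∧ m j = 0) := by
  obtain ⟨e₁, f₁, h₁, hp₁, h₁'⟩ := exists_isOddPair a i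
  have h2 : Λ h = (m i + m j) / z := by
    rw [wt_add, wt_single, wt_single, toCartan_add] at hh
    have := congrArg Λ hh
    rw [map_add, hm, hm, map_smul, smul_eq_mul] at this
    rw [this, mul_div_cancel_left₀ _ hz]
  rw [hL.isIntegrableAt_iff hij hp₁ hp hih, h2, h₁', hm, div_eq_zero_iff, or_iff_left hz]
  refine and_congr_right fun _ => ⟨fun h3 h4 => ?_, fun h3 h4 => (h3 h4).1⟩
  have h5 := h3 h4
  exact ⟨h5, by rwa [h5, zero_add] at h4⟩

theorem IsL.isIntegrableAt_evenRoot {Λ : Weight} (hL : ρ.IsL Λ) {m : Fin 4 → ℂ}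
    (hm : ∀ i, Λ (toCartan a (simpleRoot i)) = m i) {i j : Fin 4} (hij : i ≠ j) {k : Fin 3}
    (hk : sigma a k ≠ 0) (hβ : Pi.single i 1 + Pi.single j 1 = evenRoot k)
    (hik : simpleRoot i (cartanH k) = 1) :
    ρ.IsIntegrableAt (simpleRoot i + simpleRoot j) ↔
      IsNat ((m i + m j) / sigma a k) ∧ (m i + m j = 0 → m i = 0 ∧ m j = 0) :=
  hL.isIntegrableAt_iff_label hm hij hk (hβ ▸ isEvenPair_evenRoot a k) hik
    (hβ ▸ toCartan_wt_evenRoot a k)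

theorem IsL.isIntegrableAt_neg_evenRoot {Λ : Weight} (hL : ρ.IsL Λ) {m : Fin 4 → ℂ}
    (hm : ∀ i, Λ (toCartan a (simpleRoot i)) = m i) {i j : Fin 4} (hij : i ≠ j) {k : Fin 3}
    (hk : sigma a k ≠ 0) (hβ : Pi.single i 1 + Pi.single j 1 = -evenRoot k + imRoot 1)
    (hik : simpleRoot i (-cartanH k + (sigma a k)⁻¹ • cartanK) = 1) :
    ρ.IsIntegrableAt (simpleRoot i + simpleRoot j) ↔
      IsNat ((m i + m j) / sigma a k) ∧ (m i + m j = 0 → m i = 0 ∧ m j = 0) :=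
  hL.isIntegrableAt_iff_label hm hij hk (hβ ▸ isEvenPair_neg_evenRoot a k) hik
    (hβ ▸ toCartan_wt_neg_evenRoot a hk)

/-! ### All real roots of an affine `sl₂` -/

/-- Bracketing twice with N t^m turns M t^n into -2 N t^(2m+n), so `LocNilp.comm_comm` applies. The
inner central term is killed by the outer bracket, whose own cocycle vanishes since tr(N[N, M]) = 0.
-/
theorem locNilp_loop_of_locNilp {k : Fin 3} {N M : SL2}
    (hN : (N : Matrix (Fin 2) (Fin 2) ℂ) * N = 0) (hNM : ⁅N, ⁅N, M⁆⁆ = (-2 : ℂ) • N) {m n : ℤ}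
    {c : Fin 4 → ℤ} (hc : loop m (evenG k N) ∈ rootSpace a (wt c))
    (hg : loop n (evenG k M) ∈ generators a) (h1 : LocNilp (ρ.act (loop m (evenG k N))))
    (h2 : LocNilp (ρ.act (loop n (evenG k M)))) :
    LocNilp (ρ.act (loop (m + (m + n)) (evenG k N))) := by
  have hN' := loop_evenG_mem_parity m k N
  have h4 : affBracket a (loop m (evenG k N)) (loop n (evenG k M)) ∈ parity 0 :=
    affBracket_evenG_mem_parity a (loop_evenG_mem_parity n k M)
  have h5 := h1.comm_comm h2 (comm_comm_comm_act hN hc hg)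
  rw [← act_affBracket_eq_comm hN' (loop_evenG_mem_parity n k M), ← act_affBracket_eq_comm hN' h4,
    affBracket_loop a m n, affBracket_loop_loop_add_central, affBracket_loop_of_form_eq_zero,
    bracket_evenG_evenG, bracket_evenG_evenG, hNM, evenG_smul, loop_smul, map_smul] at h5
  · have h6 := h5.smul (-2)⁻¹
    rwa [smul_smul, inv_mul_cancel₀ (by norm_num), one_smul] at h6
  · rw [bracket_evenG_evenG, form_evenG]
    simp only [evenG, Pi.single_eq_same, trace_mul_lie hN, mul_zero]

theorem loop_eSL2_mem_generators (a : ℂ) (n : ℤ) (k : Fin 3) :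
    loop n (evenG k eSL2) ∈ generators a :=
  Or.inr ⟨_, isRoot_evenRoot k n, loop_eSL2_mem a n k, 0, loop_evenG_mem_parity _ _ _⟩

theorem loop_fSL2_mem_generators (a : ℂ) (n : ℤ) (k : Fin 3) :
    loop n (evenG k fSL2) ∈ generators a :=
  Or.inr ⟨_, isRoot_neg_evenRoot k n, loop_fSL2_mem a n k, 0, loop_evenG_mem_parity _ _ _⟩

theorem lie_eSL2_lie : ⁅eSL2, ⁅eSL2, fSL2⁆⁆ = (-2 : ℂ) • eSL2 := by
  rw [lie_eSL2_fSL2, ← lie_skew, lie_hSL2_eSL2, neg_smul]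

theorem lie_fSL2_lie : ⁅fSL2, ⁅fSL2, eSL2⁆⁆ = (-2 : ℂ) • fSL2 := by
  rw [← lie_skew fSL2 eSL2, lie_eSL2_fSL2, lie_neg, lie_skew, lie_hSL2_fSL2]

/-- A positive root vector kills the highest weight vector, and irreducibility spreads the
nilpotency. -/
theorem IsL.locNilp_eSL2_of_nonneg {Λ : Weight} (hL : ρ.IsL Λ) (k : Fin 3) {n : ℤ} (hn : 0 ≤ n) :
    LocNilp (ρ.act (loop n (evenG k eSL2))) := by
  obtain ⟨hρ, v, hv⟩ := hL
  refine locNilp_of_pow_apply_eq_zero hρ (loop_evenG_mem_parity _ _ _)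
    (fun x hx => comm_comm_comm_act coe_eSL2_mul_self (loop_eSL2_mem a n k) hx) hv.1 (n := 1) ?_
  rw [pow_one]
  refine (IsSingular.of_isHighestWeightVector hv).act_eq_zero _ (isRoot_evenRoot k n) ?_ _
    ⟨loop_eSL2_mem a n k, 0, loop_evenG_mem_parity _ _ _⟩
  fin_cases k <;> simp [dot, height, Fin.sum_univ_four, evenRoot, imRoot] <;> omega

theorem IsL.locNilp_fSL2_of_pos {Λ : Weight} (hL : ρ.IsL Λ) (k : Fin 3) {n : ℤ} (hn : 0 < n) :
    LocNilp (ρ.act (loop n (evenG k fSL2))) := by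
  obtain ⟨hρ, v, hv⟩ := hL
  refine locNilp_of_pow_apply_eq_zero hρ (loop_evenG_mem_parity _ _ _)
    (fun x hx => comm_comm_comm_act coe_fSL2_mul_self (loop_fSL2_mem a n k) hx) hv.1 (n := 1) ?_
  rw [pow_one]
  refine (IsSingular.of_isHighestWeightVector hv).act_eq_zero _ (isRoot_neg_evenRoot k n) ?_ _
    ⟨loop_fSL2_mem a n k, 0, loop_evenG_mem_parity _ _ _⟩
  fin_cases k <;> simp [dot, height, Fin.sum_univ_four, evenRoot, imRoot] <;> omega

theorem IsL.locNilp_loop {Λ : Weight} (hL : ρ.IsL Λ) {k : Fin 3}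
    (h0 : LocNilp (ρ.act (loop 0 (evenG k fSL2))))
    (h1 : LocNilp (ρ.act (loop (-1) (evenG k eSL2)))) (n : ℕ) :
    LocNilp (ρ.act (loop (-(n : ℤ)) (evenG k fSL2))) ∧
      LocNilp (ρ.act (loop (-((n : ℤ) + 1)) (evenG k eSL2))) := by
  induction n with
  | zero => exact ⟨by simpa using h0, by simpa using h1⟩
  | succ n ih =>
    -- The partners e t^(n-1) and f t^n belong to positive roots when n ≥ 1; for n = 0 they are the
    -- vectors of the hypotheses `h1` and `h0`. Their degrees are chosen so that 2(-n) + (n-1) =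
    -- -(n+1) and 2(-(n+1)) + n = -(n+2).
    have he : LocNilp (ρ.act (loop ((n : ℤ) - 1) (evenG k eSL2))) := by
      rcases n with _ | n
      · simpa using h1
      · exact hL.locNilp_eSL2_of_nonneg k (by push_cast; omega)
    have hf : LocNilp (ρ.act (loop (n : ℤ) (evenG k fSL2))) := by
      rcases n with _ | n
      · exact h0
      · exact hL.locNilp_fSL2_of_pos k (by push_cast; omega)
    have h2 := locNilp_loop_of_locNilp coe_fSL2_mul_self lie_fSL2_lie (loop_fSL2_mem a _ k)
      (loop_eSL2_mem_generators a _ k) ih.1 he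
    have h3 := locNilp_loop_of_locNilp coe_eSL2_mul_self lie_eSL2_lie (loop_eSL2_mem a _ k)
      (loop_fSL2_mem_generators a _ k) ih.2 hf
    rw [show -(n : ℤ) + (-n + (n - 1)) = -((n + 1 : ℕ) : ℤ) by push_cast; ring] at h2
    rw [show -((n : ℤ) + 1) + (-(n + 1) + n) = -(((n + 1 : ℕ) : ℤ) + 1) by push_cast; ring] at h3
    exact ⟨h2, h3⟩

theorem isIntegrableAt_evenRoot_iff (k : Fin 3) (n : ℤ) :
    ρ.IsIntegrableAt (wt (evenRoot k + imRoot n)) ↔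
      LocNilp (ρ.act (loop (-n) (evenG k fSL2))) := by
  rw [IsIntegrableAt, ← wt_neg, neg_add, ← imRoot_neg]
  refine ⟨fun H => H _ (loop_fSL2_mem a _ k), fun H x hx => ?_⟩
  obtain ⟨c, rfl⟩ := eq_smul_fSL2_of_mem_rootSpace hx
  rw [map_smul]
  exact H.smul c

theorem isIntegrableAt_neg_evenRoot_iff (k : Fin 3) (n : ℤ) :
    ρ.IsIntegrableAt (wt (-evenRoot k + imRoot n)) ↔
      LocNilp (ρ.act (loop (-n) (evenG k eSL2))) := by
  rw [IsIntegrableAt, ← wt_neg, neg_add, ← imRoot_neg, neg_neg]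
  refine ⟨fun H => H _ (loop_eSL2_mem a _ k), fun H x hx => ?_⟩
  obtain ⟨c, rfl⟩ := eq_smul_eSL2_of_mem_rootSpace hx
  rw [map_smul]
  exact H.smul c

/-- Integrability with respect to the simple roots of an affine `sl₂` implies integrability with
respect to all its real roots. -/
theorem IsL.isIntegrableAt_add_delta {Λ : Weight} (hL : ρ.IsL Λ) {k : Fin 3}
    (h0 : ρ.IsIntegrableAt (wt (evenRoot k)))
    (h1 : ρ.IsIntegrableAt (wt (-evenRoot k + imRoot 1))) (n : ℕ) :
    ρ.IsIntegrableAt (wt (evenRoot k + imRoot n)) ∧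
      ρ.IsIntegrableAt (wt (-evenRoot k + imRoot (n + 1))) := by
  have h0' : ρ.IsIntegrableAt (wt (evenRoot k + imRoot 0)) := by
    simpa using h0
  rw [isIntegrableAt_evenRoot_iff] at h0' ⊢
  rw [isIntegrableAt_neg_evenRoot_iff] at h1 ⊢
  exact hL.locNilp_loop (by simpa using h0') h1 n

end Rep

/-! ### Reduction to sums of simple roots, and the level -/

theorem delta_eq_wt : delta = wt (imRoot 1) := by
  refine LinearMap.ext fun h => ?_
  rw [wt_imRoot]; simp [delta]

theorem nsmul_delta (n : ℕ) : n • delta = wt (imRoot n) := by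
  refine LinearMap.ext fun h => ?_
  rw [wt_imRoot]; simp [delta, mul_comm]

theorem single_add_single_eq_evenRoot_zero :
    Pi.single 2 1 + Pi.single 3 1 = evenRoot 0 := by
  funext k; fin_cases k <;> simp [evenRoot]

theorem single_add_single_eq_evenRoot_one :
    Pi.single 1 1 + Pi.single 3 1 = evenRoot 1 := by
  funext k; fin_cases k <;> simp [evenRoot]

theorem single_add_single_eq_evenRoot_two :
    Pi.single 1 1 + Pi.single 2 1 = evenRoot 2 := by
  funext k; fin_cases k <;> simp [evenRoot]

theorem single_add_single_eq_neg_evenRoot_zero :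
    Pi.single 0 1 + Pi.single 1 1 = -evenRoot 0 + imRoot 1 := by
  funext k; fin_cases k <;> simp [evenRoot, imRoot]

theorem single_add_single_eq_neg_evenRoot_one :
    Pi.single 0 1 + Pi.single 2 1 = -evenRoot 1 + imRoot 1 := by
  funext k; fin_cases k <;> simp [evenRoot, imRoot]

theorem single_add_single_eq_neg_evenRoot_two :
    Pi.single 0 1 + Pi.single 3 1 = -evenRoot 2 + imRoot 1 := by
  funext k; fin_cases k <;> simp [evenRoot, imRoot]

theorem simpleRoot_add_eq_wt {i j : Fin 4} {c : Fin 4 → ℤ} (h : Pi.single i 1 + Pi.single j 1 = c) :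
    simpleRoot i + simpleRoot j = wt c := by
  rw [← h, wt_add, wt_single, wt_single]

/-- The level is the sum of the labels. -/
theorem apply_cartanK (a : ℂ) (Λ : Weight) :
    Λ cartanK = ∑ i, Λ (toCartan a (simpleRoot i)) := by
  rw [← map_sum]
  congr 1
  simp only [Fin.sum_univ_four, toCartan]
  refine Prod.ext ?_ ?_
  · funext k
    fin_cases k <;> simp [cartanK, cartanH, simpleRoot, eps, delta]
  · simp [cartanK, cartanH, cartanD, simpleRoot, eps, delta]

theorem apply_toCartan_simpleRoot {a : ℂ} {w : Fin 4 → Weight} (hw : IsFundamentalWeights a w)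
    (m : Fin 4 → ℂ) (c : ℂ) (i : Fin 4) :
    (∑ i, m i • w i + c • delta) (toCartan a (simpleRoot i)) = m i := by
  have h1 : ∀ j, w j (toCartan a (simpleRoot i)) = if j = i then 1 else 0 := fun j => hw j i
  have h2 : delta (toCartan a (simpleRoot i)) = 0 := by
    fin_cases i <;> simp [delta, toCartan, simpleRoot, cartanK, eps]
  simp [LinearMap.add_apply, LinearMap.sum_apply, h1, h2]

namespace Rep

variable {a : ℂ} {V : Type*} [AddCommGroup V] [Module ℂ V] {ρ : Rep a V}

/-- Integrability reduces to the simple roots of the two affine `sl₂`'s. -/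
theorem IsL.isIntegrable_iff {Λ : Weight} (hL : ρ.IsL Λ) :
    ρ.IsIntegrable ↔
      (ρ.IsIntegrableAt (simpleRoot 1 + simpleRoot 2) ∧
        ρ.IsIntegrableAt (simpleRoot 0 + simpleRoot 3)) ∧
      ρ.IsIntegrableAt (simpleRoot 1 + simpleRoot 3) ∧
        ρ.IsIntegrableAt (simpleRoot 0 + simpleRoot 2) := by
  rw [IsIntegrable, sharpRoots, simpleRoot_add_eq_wt single_add_single_eq_evenRoot_two,
    simpleRoot_add_eq_wt single_add_single_eq_evenRoot_one,
    simpleRoot_add_eq_wt single_add_single_eq_neg_evenRoot_two,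
    simpleRoot_add_eq_wt single_add_single_eq_neg_evenRoot_one]
  constructor
  · rintro ⟨h1, h2, h3⟩
    refine ⟨⟨h1, ?_⟩, h2, ?_⟩
    -- α_0 + α_3 = δ - (α_1 + α_2) is one of the required roots, with n = 1; likewise α_0 + α_2
    -- below.
    · have := h3 (-wt (evenRoot 2)) (by simp) 1 one_pos
      rwa [one_smul, delta_eq_wt, ← wt_neg, ← wt_add] at this
    · have := h3 (-wt (evenRoot 1)) (by simp) 1 one_pos
      rwa [one_smul, delta_eq_wt, ← wt_neg, ← wt_add] at this
  · rintro ⟨⟨h1, h2⟩, h3, h4⟩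
    have key : ∀ k : Fin 3, ρ.IsIntegrableAt (wt (evenRoot k)) →
        ρ.IsIntegrableAt (wt (-evenRoot k + imRoot 1)) → ∀ n : ℕ, 0 < n →
        ρ.IsIntegrableAt (wt (evenRoot k) + n • delta) ∧
          ρ.IsIntegrableAt (-wt (evenRoot k) + n • delta) := by
      intro k h5 h6 n hn
      rw [nsmul_delta, ← wt_neg, ← wt_add, ← wt_add]
      refine ⟨(hL.isIntegrableAt_add_delta h5 h6 n).1, ?_⟩
      obtain ⟨n, rfl⟩ := Nat.exists_eq_succ_of_ne_zero hn.ne'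
      exact_mod_cast (hL.isIntegrableAt_add_delta h5 h6 n).2
    refine ⟨h1, h3, ?_⟩
    rintro α (rfl | rfl | rfl | rfl) n hn
    · exact (key 2 h1 h2 n hn).1
    · exact (key 2 h1 h2 n hn).2
    · exact (key 1 h3 h4 n hn).1
    · exact (key 1 h3 h4 n hn).2

end Rep

/-- The arithmetic of the level: if `k = a A = -(a + 1) B` with natural numbers `A`, `B` and
`k ≠ 0`, then `a = -B / (A + B)` and `k = -A B / (A + B)`. -/
theorem exists_coprime_of_level {a k : ℂ} {A B : ℕ} (hA : k = a * A) (hB : k = -(a + 1) * B)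
    (hk : k ≠ 0) : ∃ p q n : ℕ, 0 < p ∧ 0 < q ∧ 0 < n ∧ p.Coprime q ∧
      a = -(p : ℂ) / (p + q) ∧ k = -((p : ℂ) * q * n) / (p + q) := by
  have hA0 : 0 < A := Nat.pos_of_ne_zero fun h => hk (by rw [hA, h]; simp)
  have hB0 : 0 < B := Nat.pos_of_ne_zero fun h => hk (by rw [hB, h]; simp)
  -- p and q are B and A divided by their gcd, and that gcd serves as n.
  obtain ⟨q, hq⟩ := Nat.gcd_dvd_right B A
  obtain ⟨p, hp⟩ := Nat.gcd_dvd_left B A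
  have hg : 0 < B.gcd A := Nat.gcd_pos_of_pos_left _ hB0
  have hco : p.Coprime q := by
    have h1 := Nat.coprime_div_gcd_div_gcd hg
    rwa [Nat.div_eq_of_eq_mul_right hg hp, Nat.div_eq_of_eq_mul_right hg hq] at h1
  generalize B.gcd A = g at *
  subst hp hq
  have hp0 : 0 < p := Nat.pos_of_mul_pos_left hB0
  have hq0 : 0 < q := Nat.pos_of_mul_pos_left hA0
  have hpq : (p : ℂ) + q ≠ 0 := by exact_mod_cast (by omega : p + q ≠ 0)
  have hg' : (g : ℂ) ≠ 0 := by exact_mod_cast hg.ne'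
  have ha : a = -(p : ℂ) / (p + q) := by
    rw [eq_div_iff hpq]
    rw [hA] at hB
    push_cast at hB
    refine mul_left_cancel₀ hg' ?_
    linear_combination hB
  refine ⟨p, q, g, hp0, hq0, hg, hco, ha, ?_⟩
  rw [hA, ha]
  push_cast
  field_simp

end

end D21

theorem theorem6p3 (a : ℂ) (ha0 : a ≠ 0) (ha1 : a ≠ -1)
    (w : Fin 4 → D21.Weight) (hw : D21.IsFundamentalWeights a w)
    (m : Fin 4 → ℂ) (c : ℂ) (Λ : D21.Weight) (hΛ : Λ = ∑ i, m i • w i + c • D21.delta)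
    {V : Type*} [AddCommGroup V] [Module ℂ V] (ρ : D21.Rep a V) (hL : ρ.IsL Λ) :
    Λ D21.cartanK = ∑ i, m i ∧
    (ρ.IsIntegrable ↔
      (D21.IsNat ((m 1 + m 2) / a) ∧ D21.IsNat ((m 0 + m 3) / a) ∧
        D21.IsNat (-((m 1 + m 3) / (a + 1))) ∧ D21.IsNat (-((m 0 + m 2) / (a + 1)))) ∧
      ∀ i ∈ ({0, 1} : Set (Fin 4)), ∀ j ∈ ({2, 3} : Set (Fin 4)),
        m i + m j = 0 → m i = 0 ∧ m j = 0) ∧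
    (ρ.IsIntegrableAt (D21.simpleRoot 0 + D21.simpleRoot 1) ↔
      D21.IsNat (m 0 + m 1) ∧ (m 0 + m 1 = 0 → m 0 = 0 ∧ m 1 = 0)) ∧
    (ρ.IsIntegrableAt (D21.simpleRoot 2 + D21.simpleRoot 3) ↔
      D21.IsNat (m 2 + m 3) ∧ (m 2 + m 3 = 0 → m 2 = 0 ∧ m 3 = 0)) ∧
    (ρ.IsIntegrable → Λ D21.cartanK ≠ 0 →
      ∃ p q n : ℕ, 0 < p ∧ 0 < q ∧ 0 < n ∧ p.Coprime q ∧
        a = -(p : ℂ) / (p + q) ∧ Λ D21.cartanK = -((p : ℂ) * q * n) / (p + q)) := by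
  have ha1' : a + 1 ≠ 0 := fun h => ha1 (eq_neg_of_add_eq_zero_left h)
  have hm : ∀ i, Λ (D21.toCartan a (D21.simpleRoot i)) = m i := fun i => by
    rw [hΛ, D21.apply_toCartan_simpleRoot hw]
  have hk : Λ D21.cartanK = ∑ i, m i := by
    rw [D21.apply_cartanK a Λ]
    exact Finset.sum_congr rfl fun i _ => hm i
  -- The summand k containing the root fixes the denominator: σ_2 = a, σ_1 = -(a+1), σ_0 = 1.
  have h12 := hL.isIntegrableAt_evenRoot hm (i := 1) (j := 2) (k := 2) (by decide)
    (by simpa [D21.sigma] using ha0) D21.single_add_single_eq_evenRoot_two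
    (by simp [D21.simpleRoot, D21.cartanH, D21.eps])
  have h13 := hL.isIntegrableAt_evenRoot hm (i := 1) (j := 3) (k := 1) (by decide)
    (neg_ne_zero.2 ha1') D21.single_add_single_eq_evenRoot_one
    (by simp [D21.simpleRoot, D21.cartanH, D21.eps])
  have h23 := hL.isIntegrableAt_evenRoot hm (i := 2) (j := 3) (k := 0) (by decide)
    one_ne_zero D21.single_add_single_eq_evenRoot_zero
    (by simp [D21.simpleRoot, D21.cartanH, D21.eps])
  have h03 := hL.isIntegrableAt_neg_evenRoot hm (i := 0) (j := 3) (k := 2) (by decide)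
    (by simpa [D21.sigma] using ha0) D21.single_add_single_eq_neg_evenRoot_two
    (by simp [D21.simpleRoot, D21.cartanH, D21.cartanK, D21.eps, D21.delta])
  have h02 := hL.isIntegrableAt_neg_evenRoot hm (i := 0) (j := 2) (k := 1) (by decide)
    (neg_ne_zero.2 ha1') D21.single_add_single_eq_neg_evenRoot_one
    (by simp [D21.simpleRoot, D21.cartanH, D21.cartanK, D21.eps, D21.delta])
  have h01 := hL.isIntegrableAt_neg_evenRoot hm (i := 0) (j := 1) (k := 0) (by decide)
    one_ne_zero D21.single_add_single_eq_neg_evenRoot_zero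
    (by simp [D21.simpleRoot, D21.cartanH, D21.cartanK, D21.eps, D21.delta])
  have s0 : D21.sigma a 0 = 1 := rfl
  have s1 : D21.sigma a 1 = -(a + 1) := rfl
  have s2 : D21.sigma a 2 = a := rfl
  rw [s0, div_one] at h23 h01
  rw [s1, div_neg] at h13 h02
  rw [s2] at h12 h03
  have hint : ρ.IsIntegrable ↔ _ := hL.isIntegrable_iff
  rw [h12, h03, h13, h02] at hint
  refine ⟨hk, ?_, h01, h23, ?_⟩
  · rw [hint]
    constructor
    · rintro ⟨⟨⟨h1, h2⟩, h3, h4⟩, ⟨h5, h6⟩, h7, h8⟩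
      refine ⟨⟨h1, h3, h5, h7⟩, ?_⟩
      rintro i (rfl | rfl) j (rfl | rfl)
      exacts [h8, h4, h2, h6]
    · rintro ⟨⟨h1, h3, h5, h7⟩, h⟩
      exact ⟨⟨⟨h1, h 1 (by simp) 2 (by simp)⟩, h3, h 0 (by simp) 3 (by simp)⟩,
        ⟨h5, h 1 (by simp) 3 (by simp)⟩, h7, h 0 (by simp) 2 (by simp)⟩
  · intro hI hk0
    obtain ⟨⟨⟨⟨A, hA⟩, -⟩, ⟨B, hB⟩, -⟩, ⟨⟨C, hC⟩, -⟩, ⟨D, hD⟩, -⟩ := hint.1 hI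
    -- k is the sum of m_1 + m_2 = aA and m_0 + m_3 = aB, and also of m_1 + m_3 = -(a+1)C and m_0 +
    -- m_2 = -(a+1)D.
    refine D21.exists_coprime_of_level (A := A + B) (B := C + D) ?_ ?_ hk0
    · push_cast
      rw [hk, ← hA, ← hB, Fin.sum_univ_four]
      field_simp
      ring
    · push_cast
      rw [hk, ← hC, ← hD, Fin.sum_univ_four]
      field_simp
      ring
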